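/- **Setting.** A noncommutative probability space is a complex unital $*$-algebra $\mathcal A$ with a linear form $\varphi$ such that $\varphi(1)=1$, $\varphi(x^*)=\overline{\varphi(x)}$ and $\varphi(xx^*)\ge 0$ for all $x\in\mathcal A$. The noncommutative distribution of a family $(x_i)_{i\in I}$ in $\mathcal A$ is the map $P\mapsto \varphi(P((x_i)_{i\in I}))$ on the polynomials $P\in\mathbb C\langle X_i : i\in I\rangle$ in noncommuting variables, and convergence of distributions means convergence for every such $P$. A free Brownian motion is a family $(S_t)_{t\in[0,+\infty)}$ of self-adjoint elements such that for all $t_0<t_1<\dots<t_p$ the increments $S_{t_1}-S_{t_0},\dots,S_{t_p}-S_{t_{p-1}}$ are free, and such that each $S_t$ is (centered) semicircular of variance $t$, i.e. $\varphi(S_t^k)=\frac1{2\pi}\int_{-2}^{2}(\sqrt t\,y)^k\sqrt{4-y^2}\,dy$ for all $k\ge 0$. The Chebyshev polynomials of the second kind, normalized on $[-2,2]$, are given by $U_0=1$, $U_1=X$, $XU_r=U_{r-1}+U_{r+1}$ for $r\ge1$. Let $\mathcal S$ be the group of permutations of $\{0,1,2,\dots\}$ with finite support, and let $\mathbb C[\mathcal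 S]$ be its group algebra, with the adjoint $\bigl(\sum_\sigma x_\sigma\sigma\bigr)^*=\sum_\sigma\overline{x_\sigma}\,\sigma^{-1}$ and the trace $\phi\bigl(\sum_\sigma x_\sigma\sigma\bigr)=x_{\mathrm{id}}$. For integers $r,n\ge1$ and real $t\ge0$ let $$M_r(n,t)=\frac1{n^{r/2}}\sum (0\,a_1\,a_2\cdots a_r)\in\mathbb C[\mathcal S],$$ where $(0\,a_1\cdots a_r)$ is the cycle $0\to a_1\to\cdots\to a_r\to0$ and the sum runs over all $r$-tuples $(a_1,\dots,a_r)$ of pairwise distinct integers of $[1,nt]$. **Theorem.** As $n\to\infty$, the noncommutative distribution of the family $(M_r(n,t))_{r\ge1,\,t\in[0,+\infty)}$ converges to that of a family $(M_r(t))_{r\ge1,\,t\in[0,+\infty)}$ of self-adjoint elements of some noncommutative probability space such that $(M_1(t))_{t\in[0,+\infty)}$ is a free Brownian motion and $$M_r(t)=t^{r/2}\,U_r\bigl(t^{-1/2}M_1(t)\bigr)\quad\text{for all } r\ge1,\ t>0,\qquad M_r(0)=0\quad\text{for all } r\ge1.$$ -/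

import Mathlib

open scoped ComplexOrder NNReal

/-! ### Noncommutative probability spaces -/

/-- A state on a complex unital `*`-algebra `A`; the pair `(A, φ)` is a noncommutative probability
space. -/
structure NCState (A : Type*) [Ring A] [StarRing A] [Algebra ℂ A] [StarModule ℂ A] where
  /-- The underlying linear form. -/
  toLinearMap : A →ₗ[ℂ] ℂ
  map_one : toLinearMap 1 = 1
  map_star : ∀ x : A, toLinearMap (star x) = star (toLinearMap x)
  map_mul_star_nonneg : ∀ x : A, 0 ≤ toLinearMap (x * star x)

section NCProbability

variable {A : Type*} [Ring A] [StarRing A] [Algebra ℂ A] [StarModule ℂ A]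

/-- The noncommutative distribution of a family `x`, mapping a polynomial `P` in noncommuting
variables indexed by `I` to `φ (P x)`. -/
noncomputable def ncDistribution {I : Type*} (φ : NCState A) (x : I → A) :
    FreeAlgebra ℂ I →ₗ[ℂ] ℂ :=
  φ.toLinearMap ∘ₗ (FreeAlgebra.lift ℂ x).toLinearMap

/-- Freeness of a family of elements: an alternating product of centered elements of the unital
`*`-subalgebras they generate is centered. Such a product has at least one factor. -/
def IsFreeFamily {I : Type*} (φ : NCState A) (x : I → A) : Prop :=
  ∀ (k : ℕ) (i : Fin (k + 1) → I) (a : Fin (k + 1) → A),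
    (∀ j : Fin k, i j.castSucc ≠ i j.succ) →
    (∀ j, a j ∈ StarAlgebra.adjoin ℂ {x (i j)}) →
    (∀ j, φ.toLinearMap (a j) = 0) →
    φ.toLinearMap (List.ofFn a).prod = 0

/-- The semicircular weight `√(4 - y²) / (2π)` on `[-2, 2]`. -/
noncomputable def semicircleWeight (y : ℝ) : ℝ :=
  1 / (2 * Real.pi) * Real.sqrt (4 - y ^ 2)

/-- A self-adjoint `x` is semicircular (centered) of variance `v` when its distribution is the law
of `√v * Y`, where `Y` has the semicircular weight on `[-2, 2]` as its density. In the case `v = 0`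
this is the Dirac mass at `0`. -/
def IsSemicircular (φ : NCState A) (x : A) (v : ℝ≥0) : Prop :=
  IsSelfAdjoint x ∧ ∀ k : ℕ, φ.toLinearMap (x ^ k) =
    ((∫ y in (-2 : ℝ)..2, (Real.sqrt v * y) ^ k * semicircleWeight y : ℝ) : ℂ)

/-- A free Brownian motion: a process with free increments whose value at each time `t` is
semicircular of variance `t`. -/
structure IsFreeBrownianMotion (φ : NCState A) (S : ℝ≥0 → A) : Prop where
  semicircular : ∀ t, IsSemicircular φ (S t) t
  free_increments : ∀ (p : ℕ) (t : Fin (p + 1) → ℝ≥0), StrictMono t →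
    IsFreeFamily φ (fun j : Fin p => S (t j.succ) - S (t j.castSucc))

end NCProbability

/-! ### The group algebra of a group, with its canonical trace -/

section GroupAlgebra

variable {G : Type*} [Group G]

/-- The adjoint on `ℂ[G]`: the coefficient of `star x` at `g` is the conjugate of that of `x`
at `g⁻¹`, i.e. `star (∑ x_g g) = ∑ conj x_g g⁻¹`. -/
noncomputable instance groupAlgebraStar : Star (MonoidAlgebra ℂ G) where
  star x := x.coeff.sum fun g c => MonoidAlgebra.single g⁻¹ (star c)

theorem groupAlgebra_star_single (g : G) (c : ℂ) :
    star (MonoidAlgebra.single g c : MonoidAlgebra ℂ G) = MonoidAlgebra.single g⁻¹ (star c) := by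
  change Finsupp.sum _ _ = _
  simp

theorem groupAlgebra_star_zero : star (0 : MonoidAlgebra ℂ G) = 0 := by
  change Finsupp.sum _ _ = _
  simp

theorem groupAlgebra_star_add (x y : MonoidAlgebra ℂ G) : star (x + y) = star x + star y := by
  classical
  change Finsupp.sum _ _ = Finsupp.sum _ _ + Finsupp.sum _ _
  rw [MonoidAlgebra.coeff_add, Finsupp.sum_add_index] <;> simp

noncomputable instance groupAlgebraStarRing : StarRing (MonoidAlgebra ℂ G) where
  star_involutive x := by
    induction x using MonoidAlgebra.induction_linear with
    | zero => rw [groupAlgebra_star_zero, groupAlgebra_star_zero]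
    | add f g hf hg => rw [groupAlgebra_star_add, groupAlgebra_star_add, hf, hg]
    | single g c => simp [groupAlgebra_star_single]
  star_mul x y := by
    induction x using MonoidAlgebra.induction_linear with
    | zero => simp [groupAlgebra_star_zero]
    | add f g hf hg => rw [add_mul, groupAlgebra_star_add, groupAlgebra_star_add, hf, hg, mul_add]
    | single g c =>
      induction y using MonoidAlgebra.induction_linear with
      | zero => simp [groupAlgebra_star_zero]
      | add f g hf hg =>
        rw [mul_add, groupAlgebra_star_add, groupAlgebra_star_add, hf, hg, add_mul]
      | single h d => simp [groupAlgebra_star_single, MonoidAlgebra.single_mul_single, mul_comm]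
  star_add := groupAlgebra_star_add

instance groupAlgebraStarModule : StarModule ℂ (MonoidAlgebra ℂ G) where
  star_smul c x := by
    induction x using MonoidAlgebra.induction_linear with
    | zero => simp
    | add f g hf hg => rw [smul_add, star_add, star_add, hf, hg, smul_add]
    | single g d => simp [groupAlgebra_star_single]

/-- The coefficient at the neutral element, as a linear form on `ℂ[G]`. -/
noncomputable def groupAlgebraCoeffOne (G : Type*) [Group G] : MonoidAlgebra ℂ G →ₗ[ℂ] ℂ where
  toFun x := x.coeff 1
  map_add' x y := by simp
  map_smul' c x := by simp

theorem groupAlgebraCoeffOne_single (g : G) (c : ℂ) [Decidable (g = 1)] :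
    groupAlgebraCoeffOne G (MonoidAlgebra.single g c) = if g = 1 then c else 0 := by
  change (MonoidAlgebra.single g c : MonoidAlgebra ℂ G).coeff 1 = _
  exact Finsupp.single_apply

theorem groupAlgebraCoeffOne_star (x : MonoidAlgebra ℂ G) :
    groupAlgebraCoeffOne G (star x) = star (groupAlgebraCoeffOne G x) := by
  classical
  induction x using MonoidAlgebra.induction_linear with
  | zero => simp
  | add f g hf hg => rw [star_add, map_add, map_add, hf, hg, star_add]
  | single g c =>
    rw [groupAlgebra_star_single, groupAlgebraCoeffOne_single, groupAlgebraCoeffOne_single]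
    by_cases h : g = 1 <;> simp [h]

theorem groupAlgebraCoeffOne_mul_star (x y : MonoidAlgebra ℂ G) :
    groupAlgebraCoeffOne G (y * star x) = x.coeff.sum fun g c => y.coeff g * star c := by
  classical
  induction x using MonoidAlgebra.induction_linear with
  | zero => simp
  | add f g hf hg =>
    rw [star_add, mul_add, map_add, hf, hg, MonoidAlgebra.coeff_add, Finsupp.sum_add_index] <;>
      simp [mul_add]
  | single g c =>
    induction y using MonoidAlgebra.induction_linear with
    | zero => simp
    | add f g hf hg => simp_all [add_mul]
    | single h d =>
      rw [groupAlgebra_star_single, MonoidAlgebra.single_mul_single, groupAlgebraCoeffOne_single]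
      simp only [mul_inv_eq_one]
      by_cases hh : h = g <;> simp [hh]

/-- The canonical trace `∑ x_g g ↦ x_e` on `ℂ[G]`, as a state. -/
noncomputable def groupAlgebraTrace (G : Type*) [Group G] : NCState (MonoidAlgebra ℂ G) where
  toLinearMap := groupAlgebraCoeffOne G
  map_one := by
    classical
    rw [MonoidAlgebra.one_def, groupAlgebraCoeffOne_single, if_pos rfl]
  map_star := groupAlgebraCoeffOne_star
  map_mul_star_nonneg x := by
    rw [groupAlgebraCoeffOne_mul_star]
    exact Finset.sum_nonneg fun g _ => mul_star_self_nonneg _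

end GroupAlgebra

/-! ### The permutation model -/

/-- The group of permutations of the nonnegative integers with finite support. -/
def finitePerm : Subgroup (Equiv.Perm ℕ) where
  carrier := {σ | {x | σ x ≠ x}.Finite}
  one_mem' := by simp
  mul_mem' {σ τ} hσ hτ := by
    refine (hσ.union hτ).subset fun x hx => ?_
    by_contra h
    simp only [Set.mem_union, Set.mem_ofPred_eq, not_or, not_not] at h
    exact hx (by rw [Equiv.Perm.mul_apply, h.2, h.1])
  inv_mem' {σ} hσ := by
    refine hσ.subset fun x hx h => hx ?_
    rw [Equiv.Perm.inv_eq_iff_eq]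
    exact h.symm

/-- The cycle `0 → a 0 → a 1 → ⋯ → a (r - 1) → 0`, for pairwise distinct nonzero `a j`. -/
def zeroCycle {r : ℕ} (a : Fin r → ℕ) : finitePerm :=
  ⟨(0 :: List.ofFn a).formPerm,
    Set.Finite.subset (Finset.finite_toSet _) (List.support_formPerm_le' _)⟩

/-- The `r`-tuples of pairwise distinct integers of `[1, n t]`. -/
noncomputable def distinctTuples (r n : ℕ) (t : ℝ≥0) : Finset (Fin r → ℕ) :=
  (Fintype.piFinset fun _ => Finset.Icc 1 ⌊(n : ℝ) * t⌋₊).filter Function.Injective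

/-- `M_r(n, t) = n ^ (-r / 2) * ∑ (0 a_1 ⋯ a_r)`, the sum over the `r`-tuples of pairwise distinct
integers of `[1, n t]`. -/
noncomputable def cycleSum (r n : ℕ) (t : ℝ≥0) : MonoidAlgebra ℂ finitePerm :=
  ((1 / (n : ℝ) ^ ((r : ℝ) / 2) : ℝ) : ℂ) •
    ∑ a ∈ distinctTuples r n t, MonoidAlgebra.of ℂ finitePerm (zeroCycle a)

/-!
Why the theorem holds. For a word `w = [ℓ_1, …, ℓ_r]` of time intervals, let `chaos w` be the
sequence whose `n`-th term is `n ^ (-r / 2)` times the sum of the cycles `(0 a_1 ⋯ a_r)`, where the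
`a_j` are distinct and `a_j / n` lies in `ℓ_j`. The cycle sums `M_r(n, t)` are the case where all
`ℓ_j` equal `(0, t]`. Multiplying the cycle `(0 a_1 ⋯ a_r)` by the transposition `(0 b)` on the right
does one of three things. If `b` is a new letter, it is inserted after `0`. If `b = a_1`, this letter
is deleted, which happens for about `n |ℓ ∩ ℓ_1|` values of `b`. If `b = a_j` with `j ≥ 2`, a cycle
avoiding `0` splits off. The last case is asymptotically invisible to the trace. Indeed, in a product
of permutations that is the identity, no letter is moved by exactly one factor, so every letter
occurs at least twice and `L` letters have only `O(n ^ (L / 2))` choices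
(`IsTame.norm_trace_le`); the split products have one factor `n ^ (-1 / 2)` in excess
(`splitSum_mem_negligible`). Hence, modulo the sequences that are `negligible` in all mixed moments,
`chaos w * chaos [ℓ]` is `chaos (ℓ :: w)` plus `|ℓ ∩ ℓ_1|` times `chaos` of the tail of `w`
(`chaos_cons_mul_sub_mem_negligible`): the creation and annihilation operators of the full Fock
space over `L²(ℝ₊)`.

Everything else follows from this relation. Traces converge on the algebra generated by the
`chaos [ℓ]`, since `chaos w` has trace `0` for `w ≠ []`; the limiting space is this algebra of
sequences with the limit of the traces as its state, positive as a limit of positive forms. The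
three-term recursion of the Chebyshev polynomials shows that the `r`-th one, evaluated at
`chaos [ℓ]`, is `chaos [ℓ, …, ℓ]` (`chaos_mul_aeval_scaledChebyshev_sub_mem`), which gives the limit
of the cycle sums. The same recursion identifies the law: both the state and the semicircle law
annihilate these polynomials for `r ≥ 1`. Finally, for disjoint intervals an alternating product of
such polynomials is a combination of `chaos w` with `w ≠ []`, as nothing is annihilated; this is the
freeness of the increments (`isFreeFamily_increment`).
-/

/-! ### Trace and cycles through `0` -/

theorem groupAlgebraTrace_mul_comm {G : Type*} [Group G] (x y : MonoidAlgebra ℂ G) :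
    (groupAlgebraTrace G).toLinearMap (x * y) = (groupAlgebraTrace G).toLinearMap (y * x) := by
  classical
  change groupAlgebraCoeffOne G _ = groupAlgebraCoeffOne G _
  induction x using MonoidAlgebra.induction_linear with
  | zero => simp
  | add f g hf hg => rw [add_mul, mul_add, map_add, map_add, hf, hg]
  | single g c =>
    induction y using MonoidAlgebra.induction_linear with
    | zero => simp
    | add f g hf hg => rw [add_mul, mul_add, map_add, map_add, hf, hg]
    | single h d =>
      rw [MonoidAlgebra.single_mul_single, MonoidAlgebra.single_mul_single,
        groupAlgebraCoeffOne_single, groupAlgebraCoeffOne_single, mul_comm c d]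
      simp only [show g * h = 1 ↔ h * g = 1 from mul_eq_one_comm]

/-- The cycle `0 → a_1 → ⋯ → a_r → 0` read off a list `[a_1, …, a_r]`. -/
def cyc (l : List ℕ) : finitePerm :=
  ⟨(0 :: l).formPerm, Set.Finite.subset (Finset.finite_toSet _) (List.support_formPerm_le' _)⟩

theorem coe_cyc (l : List ℕ) : (cyc l : Equiv.Perm ℕ) = (0 :: l).formPerm := rfl

theorem cyc_nil : cyc [] = 1 := Subtype.ext (by simp [coe_cyc])

theorem cyc_apply_of_notMem {l : List ℕ} {v : ℕ} (hv : v ≠ 0) (h : v ∉ l) :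
    (cyc l : Equiv.Perm ℕ) v = v :=
  List.formPerm_apply_of_notMem (by simp [hv, h])

theorem cyc_apply_ne {l : List ℕ} (h : (0 :: l).Nodup) {v : ℕ} (hv : v ∈ l) :
    (cyc l : Equiv.Perm ℕ) v ≠ v := by
  refine (List.formPerm_apply_mem_ne_self_iff _ h v (by simp [hv])).2 ?_
  have := List.length_pos_of_mem hv
  simp only [List.length_cons]; omega

theorem cyc_cons_apply_zero {b : ℕ} {l : List ℕ} (h : (0 :: b :: l).Nodup) :
    (cyc (b :: l) : Equiv.Perm ℕ) 0 = b :=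
  List.formPerm_apply_head _ _ _ h

theorem coe_cyc_singleton (b : ℕ) : (cyc [b] : Equiv.Perm ℕ) = Equiv.swap 0 b := by
  simp [coe_cyc]

/-- Multiplying by a transposition `(0 b)` on the right inserts the new letter `b` after `0`. -/
theorem cyc_mul_cyc_singleton {b : ℕ} {l : List ℕ} (h : (0 :: b :: l).Nodup) :
    cyc l * cyc [b] = cyc (b :: l) := by
  apply Subtype.ext
  rw [Subgroup.coe_mul, coe_cyc_singleton, coe_cyc, coe_cyc]
  simp only [List.nodup_cons, List.mem_cons, not_or] at h
  obtain ⟨⟨hb0, h0⟩, hb, hl⟩ := h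
  rw [List.formPerm_cons_cons]
  ext x
  cases l with
  | nil => simp
  | cons c l =>
    have hn0 : (0 :: c :: l).Nodup := by simp_all
    have hnb : (b :: c :: l).Nodup := by simp_all
    rw [List.formPerm_cons_cons, List.formPerm_cons_cons]
    simp only [Equiv.Perm.mul_apply]
    have key : ∀ y, y ≠ 0 → y ≠ b → (c :: l).formPerm y ≠ 0 ∧ (c :: l).formPerm y ≠ b := by
      intro y hy0 hyb
      constructor
      · intro hh
        have := List.formPerm_apply_of_notMem h0
        exact hy0 ((c :: l).formPerm.injective (by rw [hh, this]))
      · intro hh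
        have := List.formPerm_apply_of_notMem hb
        exact hyb ((c :: l).formPerm.injective (by rw [hh, this]))
    have e0 := List.formPerm_apply_of_notMem h0
    have eb := List.formPerm_apply_of_notMem hb
    have hc0 : c ≠ 0 := by rintro rfl; simp at h0
    have hcb : c ≠ b := by rintro rfl; simp at hb
    by_cases hx0 : x = 0
    · subst hx0
      rw [Equiv.swap_apply_left, eb, Equiv.swap_apply_of_ne_of_ne (Ne.symm hb0) hcb.symm, e0,
        Equiv.swap_apply_of_ne_of_ne hb0 hc0.symm, Equiv.swap_apply_left]
    by_cases hxb : x = b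
    · subst hxb
      rw [Equiv.swap_apply_right, e0, Equiv.swap_apply_left, eb, Equiv.swap_apply_left,
        Equiv.swap_apply_of_ne_of_ne hc0 hcb]
    · rw [Equiv.swap_apply_of_ne_of_ne hx0 hxb]
      obtain ⟨k0, kb⟩ := key x hx0 hxb
      generalize (c :: l).formPerm x = y at k0 kb
      by_cases hy : y = c
      · subst hy; simp
      · rw [Equiv.swap_apply_of_ne_of_ne k0 hy, Equiv.swap_apply_of_ne_of_ne kb hy,
          Equiv.swap_apply_of_ne_of_ne k0 kb]

theorem cyc_cons_mul_cyc_singleton {b : ℕ} {l : List ℕ} (h : (0 :: b :: l).Nodup) :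
    cyc (b :: l) * cyc [b] = cyc l := by
  rw [← cyc_mul_cyc_singleton h, mul_assoc]
  have : cyc [b] * cyc [b] = 1 :=
    Subtype.ext (by rw [Subgroup.coe_mul, coe_cyc_singleton, Equiv.swap_mul_self]; rfl)
  rw [this, mul_one]

/-! ### Sums of permutations indexed by words -/

/-- The number of words of length `r` in fewer than `N` letters in which no letter occurs exactly
once is `O(N ^ (r / 2))`. -/
theorem card_words_le (r N : ℕ) (D : Finset (List ℕ))
    (hD : ∀ l ∈ D, l.length = r ∧ (∀ v ∈ l, v < N) ∧ ∀ v, l.count v ≠ 1) :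
    D.card ≤ (r / 2) ^ r * N ^ (r / 2) := by
  classical
  -- such a word uses at most `r / 2` letters, so it factors through `Fin (r / 2)`
  have hsub : D ⊆ (Finset.univ : Finset ((Fin r → Fin (r / 2)) × (Fin (r / 2) → Fin N))).image
      (fun p => List.ofFn fun i => (p.2 (p.1 i) : ℕ)) := by
    intro l hl
    obtain ⟨hlen, hlt, hcount⟩ := hD l hl
    have hcard : l.toFinset.card ≤ r / 2 := by
      have h1 := List.sum_toFinset_count_eq_length l
      have h2 : ∑ v ∈ l.toFinset, 2 ≤ ∑ v ∈ l.toFinset, l.count v := by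
        refine Finset.sum_le_sum fun v hv => ?_
        have := hcount v
        have := List.count_pos_iff.2 (List.mem_toFinset.1 hv)
        omega
      rw [Finset.sum_const, smul_eq_mul, h1, hlen] at h2
      omega
    rcases Nat.eq_zero_or_pos r with h0 | hpos
    · subst h0
      have : l = [] := List.length_eq_zero_iff.1 hlen
      subst this
      simp only [Finset.mem_image, Finset.mem_univ, true_and, List.ofFn_zero]
      exact ⟨⟨Fin.elim0, fun i => absurd i.2 (by simp)⟩, trivial⟩
    · have hne : l ≠ [] := by rintro rfl; simp at hlen; omega
      obtain ⟨v0, hv0⟩ := List.exists_mem_of_ne_nil l hne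
      have : Nonempty (l.toFinset ↪ Fin (r / 2)) := by
        rw [Function.Embedding.nonempty_iff_card_le, Fintype.card_coe, Fintype.card_fin]
        exact hcard
      obtain ⟨e⟩ := this
      have : Nonempty l.toFinset := ⟨⟨v0, by simpa using hv0⟩⟩
      simp only [Finset.mem_image, Finset.mem_univ, true_and]
      let g : Fin (r / 2) → l.toFinset := Function.invFun e
      refine ⟨⟨fun i => e ⟨l.get (i.cast hlen.symm), by simp⟩,
        fun k => ⟨g k, hlt _ (List.mem_toFinset.1 (g k).2)⟩⟩, ?_⟩
      subst hlen
      simp [g, Function.leftInverse_invFun e.injective _]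
  refine (Finset.card_le_card hsub).trans (Finset.card_image_le.trans ?_)
  simp [Fintype.card_prod]

/-- Sequences in the group algebra of the finite permutations. -/
abbrev PermSeq : Type := ℕ → MonoidAlgebra ℂ finitePerm

/-- The trace on `ℂ[𝒮]` as a linear form. -/
noncomputable abbrev permTrace : MonoidAlgebra ℂ finitePerm →ₗ[ℂ] ℂ :=
  (groupAlgebraTrace finitePerm).toLinearMap

/-- `IsTame ε x` says that, for some `r` and `K`, the `n`-th term of `x` is a linear combination of
permutations indexed by words of length `r` in `[1, K n)`, with coefficients at most
`ε n * n ^ (-r / 2)`, where the permutation indexed by a word moves no nonzero integer outside of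
the word, and does move every nonzero integer that occurs exactly once in it. -/
def IsTame (ε : ℕ → ℝ) (x : PermSeq) : Prop :=
  ∃ r K : ℕ, ∀ n, 0 < n → ∃ (D : Finset (List ℕ)) (c : List ℕ → ℂ) (σ : List ℕ → finitePerm),
    x n = ∑ l ∈ D, MonoidAlgebra.single (σ l) (c l) ∧
    ∀ l ∈ D, l.length = r ∧ (∀ v ∈ l, 0 < v ∧ v < K * n) ∧ ‖c l‖ * √(n : ℝ) ^ r ≤ ε n ∧
      ∀ v, v ≠ 0 → (v ∉ l → (σ l : Equiv.Perm ℕ) v = v) ∧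
        (l.count v = 1 → (σ l : Equiv.Perm ℕ) v ≠ v)

theorem IsTame.one : IsTame (fun _ => 1) (1 : PermSeq) := by
  refine ⟨0, 0, fun n _ => ⟨{[]}, fun _ => 1, fun _ => 1, ?_, ?_⟩⟩
  · simp [MonoidAlgebra.one_def]
  · simp

theorem IsTame.mul {ε δ : ℕ → ℝ} {x y : PermSeq} (hx : IsTame ε x) (hy : IsTame δ y) :
    IsTame (fun n => ε n * δ n) (x * y) := by
  classical
  obtain ⟨r, K, hx⟩ := hx
  obtain ⟨s, L, hy⟩ := hy
  refine ⟨r + s, max K L, fun n hn => ?_⟩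
  obtain ⟨D, c, σ, hxn, hD⟩ := hx n hn
  obtain ⟨E, d, τ, hyn, hE⟩ := hy n hn
  refine ⟨(D ×ˢ E).image fun p => p.1 ++ p.2, fun l => c (l.take r) * d (l.drop r),
    fun l => σ (l.take r) * τ (l.drop r), ?_, ?_⟩
  · rw [Pi.mul_apply, hxn, hyn, Finset.sum_mul_sum, Finset.sum_image, Finset.sum_product]
    · refine Finset.sum_congr rfl fun l hl => Finset.sum_congr rfl fun m hm => ?_
      simp [← (hD l hl).1, MonoidAlgebra.single_mul_single]
    · rintro ⟨l, m⟩ hl ⟨l', m'⟩ hl' h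
      simp only [Finset.coe_product, Set.mem_prod, Finset.mem_coe] at hl hl'
      have := List.append_inj h (by rw [(hD _ hl.1).1, (hD _ hl'.1).1])
      exact Prod.ext this.1 this.2
  · intro w hw
    obtain ⟨⟨l, m⟩, hlm, rfl⟩ := Finset.mem_image.1 hw
    obtain ⟨hl, hm⟩ := Finset.mem_product.1 hlm
    obtain ⟨hl1, hl2, hl3, hl4⟩ := hD l hl
    obtain ⟨hm1, hm2, hm3, hm4⟩ := hE m hm
    have e1 : (l ++ m).take r = l := by simp [← hl1]
    have e2 : (l ++ m).drop r = m := by simp [← hl1]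
    simp only [e1, e2]
    refine ⟨by simp [hl1, hm1], ?_, ?_, ?_⟩
    · intro v hv
      rcases List.mem_append.1 hv with h | h
      · exact ⟨(hl2 v h).1, (hl2 v h).2.trans_le (Nat.mul_le_mul_right _ (le_max_left _ _))⟩
      · exact ⟨(hm2 v h).1, (hm2 v h).2.trans_le (Nat.mul_le_mul_right _ (le_max_right _ _))⟩
    · calc ‖c l * d m‖ * √(n : ℝ) ^ (r + s)
          = (‖c l‖ * √(n : ℝ) ^ r) * (‖d m‖ * √(n : ℝ) ^ s) := by rw [norm_mul, pow_add]; ring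
        _ ≤ ε n * δ n := mul_le_mul hl3 hm3 (by positivity) (le_trans (by positivity) hl3)
    · intro v hv
      rw [List.count_append, List.mem_append, not_or, Subgroup.coe_mul, Equiv.Perm.mul_apply]
      refine ⟨fun h => by rw [(hm4 v hv).1 h.2, (hl4 v hv).1 h.1], fun h => ?_⟩
      rcases Nat.eq_zero_or_pos (m.count v) with h0 | hpos
      · rw [(hm4 v hv).1 (List.count_eq_zero.1 h0)]
        exact (hl4 v hv).2 (by omega)
      · intro hh
        refine (hm4 v hv).2 (by omega) ((σ l : Equiv.Perm ℕ).injective ?_)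
        rw [hh, (hl4 v hv).1 (List.count_eq_zero.1 (by omega))]

/-- In a word whose permutation is the identity every letter occurs at least twice, so that
there are only `O(n ^ (r / 2))` such words. -/
theorem IsTame.norm_trace_le {ε : ℕ → ℝ} {x : PermSeq} (hx : IsTame ε x) :
    ∃ C : ℝ, ∀ n, 0 < n → ‖permTrace (x n)‖ ≤ C * |ε n| := by
  classical
  obtain ⟨r, K, hx⟩ := hx
  refine ⟨((r / 2 : ℕ) : ℝ) ^ r * (K : ℝ) ^ (r / 2), fun n hn => ?_⟩
  obtain ⟨D, c, σ, hxn, hD⟩ := hx n hn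
  have hn1 : (1 : ℝ) ≤ √(n : ℝ) := by
    rw [Real.one_le_sqrt]; exact_mod_cast hn
  have hcard : ((D.filter fun l => σ l = 1).card : ℝ)
      ≤ ((r / 2 : ℕ) : ℝ) ^ r * ((K : ℝ) * n) ^ (r / 2) := by
    have := card_words_le r (K * n) (D.filter fun l => σ l = 1) (by
      intro l hl
      obtain ⟨hl, hσ⟩ := Finset.mem_filter.1 hl
      obtain ⟨h1, h2, -, h4⟩ := hD l hl
      refine ⟨h1, fun v hv => (h2 v hv).2, fun v hv => ?_⟩
      have hmem : v ∈ l := List.count_pos_iff.1 (by omega)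
      exact (h4 v (h2 v hmem).1.ne').2 hv (by rw [hσ]; rfl))
    exact_mod_cast this
  have htr : permTrace (x n) = ∑ l ∈ D.filter (fun l => σ l = 1), c l := by
    rw [hxn, map_sum, Finset.sum_filter]
    exact Finset.sum_congr rfl fun l _ => groupAlgebraCoeffOne_single _ _
  have hpow : (n : ℝ) ^ (r / 2) ≤ √(n : ℝ) ^ r := by
    calc (n : ℝ) ^ (r / 2) = √(n : ℝ) ^ (2 * (r / 2)) := by
          rw [pow_mul, Real.sq_sqrt (Nat.cast_nonneg n)]
      _ ≤ _ := pow_le_pow_right₀ hn1 (by omega)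
  have hpos : 0 < √(n : ℝ) ^ r := by positivity
  rw [htr]
  calc ‖∑ l ∈ D.filter (fun l => σ l = 1), c l‖
      ≤ ∑ l ∈ D.filter (fun l => σ l = 1), |ε n| / √(n : ℝ) ^ r := by
        refine norm_sum_le_of_le _ fun l hl => ?_
        rw [le_div_iff₀ hpos]
        exact ((hD l (Finset.mem_filter.1 hl).1).2.2.1).trans (le_abs_self _)
    _ = ((D.filter fun l => σ l = 1).card : ℝ) * (|ε n| / √(n : ℝ) ^ r) := by simp
    _ ≤ (((r / 2 : ℕ) : ℝ) ^ r * ((K : ℝ) * n) ^ (r / 2)) * (|ε n| / √(n : ℝ) ^ r) := by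
        gcongr
    _ = ((r / 2 : ℕ) : ℝ) ^ r * (K : ℝ) ^ (r / 2) * |ε n| *
          ((n : ℝ) ^ (r / 2) / √(n : ℝ) ^ r) := by rw [mul_pow]; ring
    _ ≤ ((r / 2 : ℕ) : ℝ) ^ r * (K : ℝ) ^ (r / 2) * |ε n| * 1 := by
        gcongr
        exact (div_le_one hpos).2 hpow
    _ = _ := mul_one _

/-! ### Negligible sequences -/

/-- The algebra generated by the tame sequences whose normalized coefficients are bounded. -/
noncomputable def tameAlgebra : Subalgebra ℂ PermSeq :=
  Algebra.adjoin ℂ {x | ∃ C : ℝ, IsTame (fun _ => C) x}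

/-- The sequences that are asymptotically orthogonal to all tame ones. As the trace is tracial, they form
a bimodule over `tameAlgebra`, and so do not contribute to limits of mixed moments. -/
noncomputable def negligible : Submodule ℂ PermSeq where
  carrier := {x | ∀ (C : ℝ) (y : PermSeq), IsTame (fun _ => C) y →
    Filter.Tendsto (fun n => permTrace (x n * y n)) Filter.atTop (nhds 0)}
  zero_mem' C y _ := by simp
  add_mem' hx hx' C y hy := by
    simpa [add_mul] using (hx C y hy).add (hx' C y hy)
  smul_mem' c x hx C y hy := by
    simpa using (hx C y hy).const_mul c

theorem negligible_mul {x y : PermSeq} (hx : x ∈ negligible) (hy : y ∈ tameAlgebra) :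
    x * y ∈ negligible := by
  unfold tameAlgebra at hy
  induction hy using Algebra.adjoin_induction generalizing x with
  | mem y hy =>
    obtain ⟨C, hy⟩ := hy
    intro D z hz
    simpa [mul_assoc] using hx _ _ (hy.mul hz)
  | algebraMap c =>
    rw [← Algebra.commutes, ← Algebra.smul_def]
    exact negligible.smul_mem c hx
  | add y z _ _ hy hz => rw [mul_add]; exact negligible.add_mem (hy hx) (hz hx)
  | mul y z _ _ hy hz => rw [← mul_assoc]; exact hz (hy hx)

theorem mul_negligible {x y : PermSeq} (hx : x ∈ negligible) (hy : y ∈ tameAlgebra) :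
    y * x ∈ negligible := by
  unfold tameAlgebra at hy
  induction hy using Algebra.adjoin_induction generalizing x with
  | mem y hy =>
    obtain ⟨C, hy⟩ := hy
    intro D z hz
    refine (hx _ _ (hz.mul hy)).congr fun n => ?_
    rw [Pi.mul_apply, Pi.mul_apply, ← mul_assoc, groupAlgebraTrace_mul_comm, mul_assoc]
  | algebraMap c =>
    rw [← Algebra.smul_def]
    exact negligible.smul_mem c hx
  | add y z _ _ hy hz => rw [add_mul]; exact negligible.add_mem (hy hx) (hz hx)
  | mul y z _ _ hy hz => rw [mul_assoc]; exact hy (hz hx)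

theorem tendsto_trace_of_mem_negligible {x : PermSeq} (hx : x ∈ negligible) :
    Filter.Tendsto (fun n => permTrace (x n)) Filter.atTop (nhds 0) := by
  simpa using hx 1 1 IsTame.one

theorem IsTame.mem_negligible {ε : ℕ → ℝ} {x : PermSeq} (hx : IsTame ε x)
    (hε : Filter.Tendsto ε Filter.atTop (nhds 0)) : x ∈ negligible := by
  intro C y hy
  obtain ⟨M, hM⟩ := (hx.mul hy).norm_trace_le
  refine squeeze_zero_norm' (a := fun n => M * |ε n * C|) ?_ ?_
  · filter_upwards [Filter.eventually_gt_atTop 0] with n hn using hM n hn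
  · simpa using ((hε.mul_const C).abs.const_mul M)

/-! ### Sums of cycles over words of intervals -/

/-- The integers of the interval `(n s, n t]`, where `ℓ = (s, t)`. -/
noncomputable def scaledInterval (n : ℕ) (ℓ : ℝ≥0 × ℝ≥0) : Finset ℕ :=
  Finset.Ioc ⌊(n : ℝ) * ℓ.1⌋₊ ⌊(n : ℝ) * ℓ.2⌋₊

/-- The length of the intersection of the intervals `(s, t]` and `(s', t']`. -/
noncomputable def overlap (ℓ ℓ' : ℝ≥0 × ℝ≥0) : ℝ :=
  max 0 (min (ℓ.2 : ℝ) ℓ'.2 - max (ℓ.1 : ℝ) ℓ'.1)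

theorem tendsto_card_inter_scaledInterval (ℓ ℓ' : ℝ≥0 × ℝ≥0) :
    Filter.Tendsto (fun n : ℕ => ((scaledInterval n ℓ ∩ scaledInterval n ℓ').card : ℝ) / n)
      Filter.atTop (nhds (overlap ℓ ℓ')) := by
  have hfl : ∀ s : ℝ≥0, Filter.Tendsto (fun n : ℕ => ((⌊(n : ℝ) * s⌋₊ : ℕ) : ℝ) / n)
      Filter.atTop (nhds (s : ℝ)) := by
    intro s
    have := (tendsto_nat_floor_mul_div_atTop (R := ℝ) s.2).comp
      (tendsto_natCast_atTop_atTop (R := ℝ))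
    refine this.congr fun n => ?_
    simp [mul_comm]
  have key := (tendsto_const_nhds (x := (0 : ℝ))).max
    (((hfl ℓ.2).min (hfl ℓ'.2)).sub ((hfl ℓ.1).max (hfl ℓ'.1)))
  refine key.congr fun n => ?_
  rw [scaledInterval, scaledInterval, Finset.Ioc_inter_Ioc, Nat.card_Ioc]
  rw [min_div_div_right (Nat.cast_nonneg n), max_div_div_right (Nat.cast_nonneg n), ← sub_div,
    ← Nat.cast_min, ← Nat.cast_max]
  have : ((min ⌊(n : ℝ) * ℓ.2⌋₊ ⌊(n : ℝ) * ℓ'.2⌋₊ - max ⌊(n : ℝ) * ℓ.1⌋₊ ⌊(n : ℝ) * ℓ'.1⌋₊ : ℕ) : ℝ)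
      = max 0 (((min ⌊(n : ℝ) * ℓ.2⌋₊ ⌊(n : ℝ) * ℓ'.2⌋₊ : ℕ) : ℝ) -
        ((max ⌊(n : ℝ) * ℓ.1⌋₊ ⌊(n : ℝ) * ℓ'.1⌋₊ : ℕ) : ℝ)) := by
    generalize min ⌊(n : ℝ) * ℓ.2⌋₊ ⌊(n : ℝ) * ℓ'.2⌋₊ = a
    generalize max ⌊(n : ℝ) * ℓ.1⌋₊ ⌊(n : ℝ) * ℓ'.1⌋₊ = b
    rcases le_total b a with h | h
    · rw [Nat.cast_sub h, max_eq_right (sub_nonneg.2 (Nat.cast_le.2 h))]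
    · rw [Nat.sub_eq_zero_of_le h, Nat.cast_zero, max_eq_left (sub_nonpos.2 (Nat.cast_le.2 h))]
  rw [this]
  conv_lhs => rw [← zero_div (n : ℝ)]
  rw [max_div_div_right (Nat.cast_nonneg n)]

/-- The words with pairwise distinct letters whose `j`-th letter is in the `j`-th interval of
`w`. -/
noncomputable def wordSet (n : ℕ) : List (ℝ≥0 × ℝ≥0) → Finset (List ℕ)
  | [] => {[]}
  | ℓ :: w => ((wordSet n w ×ˢ scaledInterval n ℓ).filter fun p => p.2 ∉ p.1).image
      fun p => p.2 :: p.1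

theorem mem_wordSet_cons {n : ℕ} {ℓ : ℝ≥0 × ℝ≥0} {w : List (ℝ≥0 × ℝ≥0)} {l : List ℕ} :
    l ∈ wordSet n (ℓ :: w) ↔
      ∃ b ∈ scaledInterval n ℓ, ∃ a ∈ wordSet n w, b ∉ a ∧ l = b :: a := by
  simp only [wordSet, Finset.mem_image, Finset.mem_filter, Finset.mem_product, Prod.exists]
  constructor
  · rintro ⟨a, b, ⟨⟨ha, hb⟩, hba⟩, rfl⟩
    exact ⟨b, hb, a, ha, hba, rfl⟩
  · rintro ⟨b, hb, a, ha, hba, rfl⟩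
    exact ⟨a, b, ⟨⟨ha, hb⟩, hba⟩, rfl⟩

theorem sum_wordSet_cons {E : Type*} [AddCommMonoid E] (n : ℕ) (ℓ : ℝ≥0 × ℝ≥0)
    (w : List (ℝ≥0 × ℝ≥0)) (f : List ℕ → E) :
    ∑ l ∈ wordSet n (ℓ :: w), f l =
      ∑ a ∈ wordSet n w, ∑ b ∈ (scaledInterval n ℓ).filter (· ∉ a), f (b :: a) := by
  rw [wordSet, Finset.sum_image, Finset.sum_filter, Finset.sum_product]
  · exact Finset.sum_congr rfl fun a _ => (Finset.sum_filter _ _).symm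
  · rintro ⟨a, b⟩ - ⟨a', b'⟩ - h
    simp only [List.cons.injEq] at h
    exact Prod.ext h.2 h.1

theorem mem_wordSet_iff {n : ℕ} {w : List (ℝ≥0 × ℝ≥0)} {l : List ℕ} :
    l ∈ wordSet n w ↔ List.Forall₂ (fun b ℓ => b ∈ scaledInterval n ℓ) l w ∧ l.Nodup := by
  induction w generalizing l with
  | nil =>
    simp only [wordSet, Finset.mem_singleton, List.forall₂_nil_right_iff]
    exact ⟨fun h => ⟨h, by simp [h]⟩, fun h => h.1⟩
  | cons ℓ w ih =>
    rw [mem_wordSet_cons]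
    constructor
    · rintro ⟨b, hb, a, ha, hba, rfl⟩
      obtain ⟨h1, h2⟩ := ih.1 ha
      exact ⟨List.Forall₂.cons hb h1, List.nodup_cons.2 ⟨hba, h2⟩⟩
    · rintro ⟨h1, h2⟩
      obtain ⟨b, a, hb, ha, rfl⟩ := List.forall₂_cons_right_iff.1 h1
      rw [List.nodup_cons] at h2
      exact ⟨b, hb, a, ih.2 ⟨ha, h2.2⟩, h2.1, rfl⟩

theorem length_of_mem_wordSet {n : ℕ} {w : List (ℝ≥0 × ℝ≥0)} {l : List ℕ}
    (h : l ∈ wordSet n w) : l.length = w.length :=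
  (mem_wordSet_iff.1 h).1.length_eq

theorem nodup_of_mem_wordSet {n : ℕ} {w : List (ℝ≥0 × ℝ≥0)} {l : List ℕ}
    (h : l ∈ wordSet n w) : l.Nodup :=
  (mem_wordSet_iff.1 h).2

theorem exists_bound_wordSet (w : List (ℝ≥0 × ℝ≥0)) :
    ∃ K : ℕ, ∀ n, 0 < n → ∀ l ∈ wordSet n w, ∀ v ∈ l, 0 < v ∧ v < K * n := by
  induction w with
  | nil => exact ⟨0, fun n _ l hl => by simp_all [wordSet]⟩
  | cons ℓ w ih =>
    obtain ⟨K, hK⟩ := ih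
    refine ⟨max K (⌈(ℓ.2 : ℝ)⌉₊ + 1), fun n hn l hl v hv => ?_⟩
    obtain ⟨b, hb, a, ha, -, rfl⟩ := mem_wordSet_cons.1 hl
    rcases List.mem_cons.1 hv with rfl | hv
    · rw [scaledInterval, Finset.mem_Ioc] at hb
      refine ⟨by omega, lt_of_lt_of_le (b := (⌈(ℓ.2 : ℝ)⌉₊ + 1) * n) ?_
        (Nat.mul_le_mul_right _ (le_max_right _ _))⟩
      have h1 : (v : ℝ) ≤ n * ℓ.2 := (Nat.le_floor_iff (by positivity)).1 hb.2
      have h2 : (n : ℝ) * ℓ.2 ≤ n * ⌈(ℓ.2 : ℝ)⌉₊ := by gcongr; exact Nat.le_ceil _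
      have h3 : v ≤ n * ⌈(ℓ.2 : ℝ)⌉₊ := by exact_mod_cast h1.trans h2
      calc v ≤ n * ⌈(ℓ.2 : ℝ)⌉₊ := h3
        _ < (⌈(ℓ.2 : ℝ)⌉₊ + 1) * n := by rw [add_mul, mul_comm]; omega
    · exact ⟨(hK n hn a ha v hv).1,
        (hK n hn a ha v hv).2.trans_le (Nat.mul_le_mul_right _ (le_max_left _ _))⟩

theorem zero_notMem_of_mem_wordSet {n : ℕ} {w : List (ℝ≥0 × ℝ≥0)} {l : List ℕ}
    (h : l ∈ wordSet n w) : 0 ∉ l := by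
  induction w generalizing l with
  | nil => simp_all [wordSet]
  | cons ℓ w ih =>
    obtain ⟨b, hb, a, ha, -, rfl⟩ := mem_wordSet_cons.1 h
    rw [scaledInterval, Finset.mem_Ioc] at hb
    simp only [List.mem_cons, not_or]
    exact ⟨by omega, ih ha⟩

theorem nodup_zero_cons_of_mem_wordSet {n : ℕ} {w : List (ℝ≥0 × ℝ≥0)} {l : List ℕ}
    (h : l ∈ wordSet n w) : (0 :: l).Nodup :=
  List.nodup_cons.2 ⟨zero_notMem_of_mem_wordSet h, nodup_of_mem_wordSet h⟩

/-- The unnormalized sum of the cycles `(0 a_1 ⋯ a_r)` over the words of `wordSet n w`. -/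
noncomputable def rawSum (n : ℕ) (w : List (ℝ≥0 × ℝ≥0)) : MonoidAlgebra ℂ finitePerm :=
  ∑ a ∈ wordSet n w, MonoidAlgebra.single (cyc a) 1

/-- The sum of the cycles `(0 a_1 ⋯ a_r)`, where `a_j` runs over the `j`-th interval of `w` scaled
by `n`, normalized by `n ^ (-r / 2)`. It plays the role of the vector `ℓ_1 ⊗ ⋯ ⊗ ℓ_r` of the full
Fock space. -/
noncomputable def chaos (w : List (ℝ≥0 × ℝ≥0)) : PermSeq :=
  fun n => (((√(n : ℝ))⁻¹ ^ w.length : ℝ) : ℂ) • rawSum n w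

theorem chaos_nil : chaos [] = 1 := by
  funext n
  simp [chaos, rawSum, wordSet, cyc_nil, MonoidAlgebra.one_def]

theorem permTrace_chaos {w : List (ℝ≥0 × ℝ≥0)} (hw : w ≠ []) (n : ℕ) :
    permTrace (chaos w n) = 0 := by
  classical
  rw [chaos, map_smul, rawSum, map_sum, Finset.sum_eq_zero, smul_zero]
  intro a ha
  refine (groupAlgebraCoeffOne_single _ _).trans (if_neg fun h => ?_)
  have hlen := length_of_mem_wordSet ha
  cases a with
  | nil => exact hw (List.length_eq_zero_iff.1 hlen.symm)
  | cons b a =>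
    refine cyc_apply_ne (nodup_zero_cons_of_mem_wordSet ha) List.mem_cons_self ?_
    rw [h]; rfl

theorem isTame_chaos (w : List (ℝ≥0 × ℝ≥0)) : IsTame (fun _ => 1) (chaos w) := by
  obtain ⟨K, hK⟩ := exists_bound_wordSet w
  refine ⟨w.length, K, fun n hn => ⟨wordSet n w, fun _ => (((√(n : ℝ))⁻¹ ^ w.length : ℝ) : ℂ),
    cyc, ?_, fun l hl => ⟨length_of_mem_wordSet hl, hK n hn l hl, ?_, fun v hv => ⟨?_, ?_⟩⟩⟩⟩
  · simp [chaos, rawSum, Finset.smul_sum]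
  · rw [Complex.norm_real, Real.norm_of_nonneg (by positivity), ← mul_pow, inv_mul_cancel₀
      (by positivity), one_pow]
  · exact cyc_apply_of_notMem hv
  · intro h
    exact cyc_apply_ne (nodup_zero_cons_of_mem_wordSet hl) (List.count_pos_iff.1 (by omega))

theorem chaos_mem_tameAlgebra (w : List (ℝ≥0 × ℝ≥0)) : chaos w ∈ tameAlgebra :=
  Algebra.subset_adjoin ⟨1, isTame_chaos w⟩

theorem sum_filter_mem_eq_sum_range {E : Type*} [AddCommMonoid E] (I : Finset ℕ) (f : ℕ → E)
    {a : List ℕ} (ha : a.Nodup) :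
    ∑ b ∈ I.filter (· ∈ a), f b =
      ∑ k ∈ Finset.range a.length, if a.getD k 0 ∈ I then f (a.getD k 0) else 0 := by
  induction a with
  | nil => simp
  | cons c a ih =>
    rw [List.nodup_cons] at ha
    rw [List.length_cons, Finset.sum_range_succ']
    simp only [List.getD_cons_succ, List.getD_cons_zero]
    rw [← ih ha.2]
    by_cases hc : c ∈ I
    · have : I.filter (· ∈ c :: a) = insert c (I.filter (· ∈ a)) := by
        ext x; simp only [Finset.mem_filter, List.mem_cons, Finset.mem_insert]
        constructor
        · tauto
        · rintro (rfl | h) <;> tauto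
      rw [this, Finset.sum_insert (by simp [ha.1]), if_pos hc, add_comm]
    · have : I.filter (· ∈ c :: a) = I.filter (· ∈ a) := by
        ext x; simp only [Finset.mem_filter, List.mem_cons]
        constructor
        · rintro ⟨h, rfl | h'⟩ <;> tauto
        · tauto
      rw [this, if_neg hc, add_zero]

/-- The sum of the products `(0 a_1 ⋯ a_r) (0 a_{k + 2})`, from which a cycle avoiding `0` splits
off. The letter `a_{k + 2}` has index `k + 1` in the list, and has to lie in the interval of `ℓ`. -/
noncomputable def splitSum (n : ℕ) (ℓ : ℝ≥0 × ℝ≥0) (w : List (ℝ≥0 × ℝ≥0)) (k : ℕ) :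
    MonoidAlgebra ℂ finitePerm :=
  ∑ a ∈ (wordSet n w).filter (fun a => a.getD (k + 1) 0 ∈ scaledInterval n ℓ),
    MonoidAlgebra.single (cyc a * cyc [a.getD (k + 1) 0]) 1

theorem rawSum_singleton (n : ℕ) (ℓ : ℝ≥0 × ℝ≥0) :
    rawSum n [ℓ] = ∑ b ∈ scaledInterval n ℓ, MonoidAlgebra.single (cyc [b]) 1 := by
  rw [rawSum, sum_wordSet_cons]
  simp [wordSet]

theorem rawSum_mul_rawSum_singleton (n : ℕ) (ℓ ℓ' : ℝ≥0 × ℝ≥0) (w : List (ℝ≥0 × ℝ≥0)) :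
    rawSum n (ℓ' :: w) * rawSum n [ℓ] = rawSum n (ℓ :: ℓ' :: w) +
      ∑ a ∈ wordSet n w, MonoidAlgebra.single (cyc a)
        (((scaledInterval n ℓ ∩ scaledInterval n ℓ').filter (· ∉ a)).card : ℂ) +
      ∑ k ∈ Finset.range w.length, splitSum n ℓ (ℓ' :: w) k := by
  classical
  have h1 : rawSum n (ℓ' :: w) * rawSum n [ℓ] =
      ∑ a ∈ wordSet n (ℓ' :: w), (∑ b ∈ (scaledInterval n ℓ).filter (· ∈ a),
        MonoidAlgebra.single (cyc a * cyc [b]) (1 : ℂ) +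
        ∑ b ∈ (scaledInterval n ℓ).filter (· ∉ a),
          MonoidAlgebra.single (cyc a * cyc [b]) (1 : ℂ)) := by
    rw [rawSum_singleton, rawSum, Finset.sum_mul_sum]
    refine Finset.sum_congr rfl fun a _ => ?_
    rw [Finset.sum_filter_add_sum_filter_not]
    simp [MonoidAlgebra.single_mul_single]
  have h2 : ∑ a ∈ wordSet n (ℓ' :: w), ∑ b ∈ (scaledInterval n ℓ).filter (· ∉ a),
      MonoidAlgebra.single (cyc a * cyc [b]) (1 : ℂ) = rawSum n (ℓ :: ℓ' :: w) := by
    rw [rawSum, sum_wordSet_cons (ℓ := ℓ)]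
    refine Finset.sum_congr rfl fun a ha => Finset.sum_congr rfl fun b hb => ?_
    rw [Finset.mem_filter] at hb
    rw [cyc_mul_cyc_singleton (nodup_zero_cons_of_mem_wordSet
      (mem_wordSet_cons.2 ⟨b, hb.1, a, ha, hb.2, rfl⟩))]
  have h3 : ∑ a ∈ wordSet n (ℓ' :: w), ∑ b ∈ (scaledInterval n ℓ).filter (· ∈ a),
      MonoidAlgebra.single (cyc a * cyc [b]) (1 : ℂ) =
      ∑ k ∈ Finset.range (w.length + 1), ∑ a ∈ wordSet n (ℓ' :: w),
        if a.getD k 0 ∈ scaledInterval n ℓ then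
          MonoidAlgebra.single (cyc a * cyc [a.getD k 0]) (1 : ℂ) else 0 := by
    rw [Finset.sum_comm]
    refine Finset.sum_congr rfl fun a ha => ?_
    rw [sum_filter_mem_eq_sum_range _ _ (nodup_of_mem_wordSet ha), length_of_mem_wordSet ha,
      List.length_cons]
  have h4 : (∑ a ∈ wordSet n (ℓ' :: w), if a.getD 0 0 ∈ scaledInterval n ℓ then
        MonoidAlgebra.single (cyc a * cyc [a.getD 0 0]) (1 : ℂ) else 0) =
      ∑ a ∈ wordSet n w, MonoidAlgebra.single (cyc a)
        (((scaledInterval n ℓ ∩ scaledInterval n ℓ').filter (· ∉ a)).card : ℂ) := by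
    rw [sum_wordSet_cons]
    refine Finset.sum_congr rfl fun a ha => ?_
    have : ∀ b ∈ (scaledInterval n ℓ').filter (· ∉ a),
        (if (b :: a).getD 0 0 ∈ scaledInterval n ℓ then
          MonoidAlgebra.single (cyc (b :: a) * cyc [(b :: a).getD 0 0]) (1 : ℂ) else 0) =
        if b ∈ scaledInterval n ℓ then MonoidAlgebra.single (cyc a) (1 : ℂ) else 0 := by
      intro b hb
      rw [Finset.mem_filter] at hb
      rw [List.getD_cons_zero, cyc_cons_mul_cyc_singleton (nodup_zero_cons_of_mem_wordSet
        (mem_wordSet_cons.2 ⟨b, hb.1, a, ha, hb.2, rfl⟩))]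
    rw [Finset.sum_congr rfl this, ← Finset.sum_filter, Finset.sum_const,
      ← Nat.cast_smul_eq_nsmul ℂ, MonoidAlgebra.smul_single, smul_eq_mul, mul_one]
    congr 3
    ext b
    simp only [Finset.mem_filter, Finset.mem_inter]
    tauto
  rw [h1, Finset.sum_add_distrib, h2, h3, Finset.sum_range_succ', h4]
  simp only [splitSum, Finset.sum_filter]
  abel

/-- Every letter of the word is still moved after the splitting, so the words of length `r` come
with the coefficient `n ^ (-(r + 1) / 2)`, a factor `n ^ (-1 / 2)` below the tame scale. -/
theorem splitSum_mem_negligible (ℓ : ℝ≥0 × ℝ≥0) (w : List (ℝ≥0 × ℝ≥0)) {k : ℕ}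
    (hk : k + 1 < w.length) :
    (fun n => (((√(n : ℝ))⁻¹ ^ (w.length + 1) : ℝ) : ℂ) • splitSum n ℓ w k : PermSeq)
      ∈ negligible := by
  have ht : IsTame (fun n => (√(n : ℝ))⁻¹)
      (fun n => (((√(n : ℝ))⁻¹ ^ (w.length + 1) : ℝ) : ℂ) • splitSum n ℓ w k : PermSeq) := by
    obtain ⟨K, hK⟩ := exists_bound_wordSet w
    refine ⟨w.length, K, fun n hn => ⟨(wordSet n w).filter (fun a =>
      a.getD (k + 1) 0 ∈ scaledInterval n ℓ), fun _ => (((√(n : ℝ))⁻¹ ^ (w.length + 1) : ℝ) : ℂ),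
      fun a => cyc a * cyc [a.getD (k + 1) 0], ?_, fun l hl => ?_⟩⟩
    · simp only [splitSum, Finset.smul_sum, MonoidAlgebra.smul_single, smul_eq_mul, mul_one]
    have hl := (Finset.mem_filter.1 hl).1
    have hlen := length_of_mem_wordSet hl
    have hnd := nodup_zero_cons_of_mem_wordSet hl
    refine ⟨hlen, hK n hn l hl, ?_, fun v hv => ?_⟩
    · have hs : √(n : ℝ) ≠ 0 := by positivity
      rw [Complex.norm_real, Real.norm_of_nonneg (by positivity), pow_succ, mul_right_comm,
        ← mul_pow, inv_mul_cancel₀ hs, one_pow, one_mul]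
    cases l with
    | nil => simp only [List.length_nil] at hlen; omega
    | cons c a =>
      rw [List.length_cons] at hlen
      have hka : k < a.length := by omega
      beta_reduce
      rw [List.getD_cons_succ, List.getD_eq_getElem _ _ hka]
      have hba : a[k] ∈ a := List.getElem_mem hka
      generalize a[k] = b at hba
      rw [Subgroup.coe_mul, Equiv.Perm.mul_apply, coe_cyc_singleton]
      have hbc : b ≠ c := by rintro rfl; simp_all
      constructor
      · intro hvl
        rw [Equiv.swap_apply_of_ne_of_ne hv (by rintro rfl; simp_all)]
        exact cyc_apply_of_notMem hv hvl
      · intro hcount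
        have hvl : v ∈ c :: a := List.count_pos_iff.1 (by omega)
        by_cases hvb : v = b
        · subst hvb
          rw [Equiv.swap_apply_right, cyc_cons_apply_zero hnd]
          exact hbc.symm
        · rw [Equiv.swap_apply_of_ne_of_ne hv hvb]
          exact cyc_apply_ne hnd hvl
  refine ht.mem_negligible ?_
  exact (Real.tendsto_sqrt_atTop.comp tendsto_natCast_atTop_atTop).inv_tendsto_atTop

/-- Multiplication by `chaos [ℓ]` acts, up to negligible sequences, as the sum of the creation and
the annihilation operators of the full Fock space. -/
theorem chaos_cons_mul_sub_mem_negligible (ℓ ℓ' : ℝ≥0 × ℝ≥0) (w : List (ℝ≥0 × ℝ≥0)) :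
    chaos (ℓ' :: w) * chaos [ℓ] - (chaos (ℓ :: ℓ' :: w) + (overlap ℓ ℓ' : ℂ) • chaos w)
      ∈ negligible := by
  classical
  -- the error made in replacing the number of letters that may be deleted by `n * overlap ℓ ℓ'`
  let e : PermSeq := fun n => ∑ a ∈ wordSet n w, MonoidAlgebra.single (cyc a)
    ((((√(n : ℝ))⁻¹ ^ w.length *
      ((((scaledInterval n ℓ ∩ scaledInterval n ℓ').filter (· ∉ a)).card : ℝ) *
        (√(n : ℝ))⁻¹ ^ 2 - overlap ℓ ℓ') : ℝ) : ℂ))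
  have hdecomp : chaos (ℓ' :: w) * chaos [ℓ] -
      (chaos (ℓ :: ℓ' :: w) + (overlap ℓ ℓ' : ℂ) • chaos w) = e +
      ∑ k ∈ Finset.range w.length, (fun n =>
        (((√(n : ℝ))⁻¹ ^ ((ℓ' :: w).length + 1) : ℝ) : ℂ) • splitSum n ℓ (ℓ' :: w) k : PermSeq) := by
    funext n
    simp only [Pi.add_apply, Pi.sub_apply, Pi.mul_apply, Pi.smul_apply, Finset.sum_apply, chaos,
      smul_mul_smul_comm, rawSum_mul_rawSum_singleton, List.length_cons, List.length_nil, e]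
    generalize (√(n : ℝ))⁻¹ = s
    rw [← Finset.smul_sum]
    have he : ∑ a ∈ wordSet n w, MonoidAlgebra.single (cyc a)
        (((s ^ w.length *
          ((((scaledInterval n ℓ ∩ scaledInterval n ℓ').filter (· ∉ a)).card : ℝ) *
            s ^ 2 - overlap ℓ ℓ') : ℝ) : ℂ)) =
        ((s ^ (w.length + 1 + 1) : ℝ) : ℂ) • ∑ a ∈ wordSet n w, MonoidAlgebra.single (cyc a)
          (((scaledInterval n ℓ ∩ scaledInterval n ℓ').filter (· ∉ a)).card : ℂ) -
        (overlap ℓ ℓ' : ℂ) • ((s ^ w.length : ℝ) : ℂ) • rawSum n w := by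
      rw [rawSum, Finset.smul_sum, Finset.smul_sum, Finset.smul_sum, ← Finset.sum_sub_distrib]
      refine Finset.sum_congr rfl fun a _ => ?_
      simp only [MonoidAlgebra.smul_single, smul_eq_mul, ← MonoidAlgebra.single_sub]
      congr 1
      push_cast
      ring
    rw [he]
    push_cast
    simp only [smul_add, pow_zero, one_mul, pow_succ]
    abel
  rw [hdecomp]
  refine negligible.add_mem ?_ (Submodule.sum_mem _ fun k hk => ?_)
  · let ε : ℕ → ℝ := fun n =>
      |((scaledInterval n ℓ ∩ scaledInterval n ℓ').card : ℝ) / n - overlap ℓ ℓ'| + w.length / n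
    have hε : Filter.Tendsto ε Filter.atTop (nhds 0) := by
      have h1 := ((tendsto_card_inter_scaledInterval ℓ ℓ').sub_const (overlap ℓ ℓ')).abs
      have h2 := tendsto_const_div_atTop_nhds_zero_nat (w.length : ℝ)
      simpa using h1.add h2
    refine IsTame.mem_negligible (ε := ε) ?_ hε
    obtain ⟨K, hK⟩ := exists_bound_wordSet w
    refine ⟨w.length, K, fun n hn => ⟨wordSet n w, _, cyc, rfl,
      fun l hl => ⟨length_of_mem_wordSet hl, hK n hn l hl, ?_, fun v hv => ⟨?_, ?_⟩⟩⟩⟩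
    · rw [Complex.norm_real, norm_mul, Real.norm_of_nonneg (by positivity), mul_right_comm,
        ← mul_pow, inv_mul_cancel₀ (by positivity), one_pow, one_mul, Real.norm_eq_abs, inv_pow,
        Real.sq_sqrt (Nat.cast_nonneg n), ← div_eq_mul_inv]
      set J := scaledInterval n ℓ ∩ scaledInterval n ℓ'
      have hc : (J.card : ℝ) = (J.filter (· ∉ l)).card + (J.filter (· ∈ l)).card := by
        rw [add_comm]
        exact_mod_cast (Finset.card_filter_add_card_filter_not (s := J) (· ∈ l)).symm
      have hc' : ((J.filter (· ∈ l)).card : ℝ) ≤ w.length := by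
        rw [← length_of_mem_wordSet hl]
        have : (J.filter (· ∈ l)) ⊆ l.toFinset := fun x hx => by
          simp only [Finset.mem_filter] at hx; simpa using hx.2
        exact_mod_cast (Finset.card_le_card this).trans l.toFinset_card_le
      have heq : ((J.filter (· ∉ l)).card : ℝ) / n - overlap ℓ ℓ' =
          ((J.card : ℝ) / n - overlap ℓ ℓ') - ((J.filter (· ∈ l)).card : ℝ) / n := by
        rw [hc]; ring
      rw [heq]
      refine (abs_sub _ _).trans ?_
      rw [abs_of_nonneg (a := ((J.filter (· ∈ l)).card : ℝ) / n) (by positivity)]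
      simp only [ε]
      gcongr
    · exact cyc_apply_of_notMem hv
    · intro h
      exact cyc_apply_ne (nodup_zero_cons_of_mem_wordSet hl) (List.count_pos_iff.1 (by omega))
  · exact splitSum_mem_negligible ℓ (ℓ' :: w) (by
      rw [List.length_cons]; have := Finset.mem_range.1 hk; omega)

/-! ### Chebyshev polynomials for the semicircle law of a given variance -/

/-- The monic polynomials `t ^ (r / 2) U_r (t ^ (-1 / 2) X)`, given by their recursion so that they
make sense for every `t`. They are orthogonal for the semicircle law of variance `t`. -/
noncomputable def scaledChebyshev (t : ℂ) : ℕ → Polynomial ℂ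
  | 0 => 1
  | 1 => Polynomial.X
  | r + 2 => scaledChebyshev t (r + 1) * Polynomial.X - Polynomial.C t * scaledChebyshev t r

theorem aeval_smul_scaledChebyshev {A : Type*} [Ring A] [Algebra ℂ A] (s : ℂ) (y : A) (r : ℕ) :
    Polynomial.aeval (s • y) (scaledChebyshev (s ^ 2) r) =
      s ^ r • Polynomial.aeval y (Polynomial.Chebyshev.S ℂ r) := by
  induction r using Nat.twoStepInduction with
  | zero => simp [scaledChebyshev]
  | one => simp [scaledChebyshev]
  | more r h0 h1 =>
    have : Polynomial.Chebyshev.S ℂ ((r + 2 : ℕ) : ℤ) = Polynomial.Chebyshev.S ℂ ((r + 1 : ℕ) : ℤ) *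
        Polynomial.X - Polynomial.Chebyshev.S ℂ (r : ℤ) := by
      push_cast
      rw [Polynomial.Chebyshev.S_add_two, mul_comm]
    rw [this, scaledChebyshev]
    simp only [map_sub, map_mul, Polynomial.aeval_X, Polynomial.aeval_C, h0, h1, smul_sub,
      ← Algebra.smul_def, smul_smul, smul_mul_smul_comm]
    ring_nf

theorem span_scaledChebyshev (t : ℂ) :
    Submodule.span ℂ (Set.range (scaledChebyshev t)) = ⊤ := by
  set V := Submodule.span ℂ (Set.range (scaledChebyshev t)) with hV
  have hmem : ∀ r, scaledChebyshev t r ∈ V := fun r => Submodule.subset_span ⟨r, rfl⟩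
  have hX : ∀ p ∈ V, p * Polynomial.X ∈ V := by
    intro p hp
    induction hp using Submodule.span_induction with
    | mem p hp =>
      obtain ⟨r, rfl⟩ := hp
      cases r with
      | zero => simpa [scaledChebyshev] using hmem 1
      | succ r =>
        have : scaledChebyshev t (r + 1) * Polynomial.X =
            scaledChebyshev t (r + 2) + t • scaledChebyshev t r := by
          rw [scaledChebyshev, Polynomial.smul_eq_C_mul]; ring
        rw [this]
        exact V.add_mem (hmem _) (V.smul_mem _ (hmem _))
    | zero => simp
    | add p q _ _ hp hq => rw [add_mul]; exact V.add_mem hp hq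
    | smul c p _ hp => rw [smul_mul_assoc]; exact V.smul_mem c hp
  rw [eq_top_iff]
  rintro p -
  induction p using Polynomial.induction_on' with
  | add p q hp hq => exact V.add_mem hp hq
  | monomial k c =>
    rw [← Polynomial.C_mul_X_pow_eq_monomial, ← Polynomial.smul_eq_C_mul]
    refine V.smul_mem c ?_
    induction k with
    | zero => simpa [scaledChebyshev] using hmem 0
    | succ k ih => rw [pow_succ]; exact hX _ ih

/-- The polynomials that are centered for the semicircle law of variance `t`. -/
noncomputable def centeredPolynomials (t : ℂ) : Submodule ℂ (Polynomial ℂ) :=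
  Submodule.span ℂ (Set.range fun r => scaledChebyshev t (r + 1))

theorem exists_eq_C_add_centered (t : ℂ) (p : Polynomial ℂ) :
    ∃ c : ℂ, ∃ q ∈ centeredPolynomials t, p = Polynomial.C c + q := by
  have hp : p ∈ Submodule.span ℂ (Set.range (scaledChebyshev t)) := by
    rw [span_scaledChebyshev]; trivial
  induction hp using Submodule.span_induction with
  | mem p hp =>
    obtain ⟨r, rfl⟩ := hp
    cases r with
    | zero => exact ⟨1, 0, Submodule.zero_mem _, by simp [scaledChebyshev]⟩
    | succ r => exact ⟨0, _, Submodule.subset_span ⟨r, rfl⟩, by simp⟩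
  | zero => exact ⟨0, 0, Submodule.zero_mem _, by simp⟩
  | add p q _ _ hp hq =>
    obtain ⟨c, p, hp, rfl⟩ := hp
    obtain ⟨d, q, hq, rfl⟩ := hq
    exact ⟨c + d, p + q, Submodule.add_mem _ hp hq, by rw [Polynomial.C_add]; ring⟩
  | smul a p _ hp =>
    obtain ⟨c, p, hp, rfl⟩ := hp
    exact ⟨a * c, a • p, Submodule.smul_mem _ _ hp, by
      rw [smul_add, Polynomial.smul_eq_C_mul, Polynomial.smul_eq_C_mul, Polynomial.C_mul,
        ← Polynomial.smul_eq_C_mul, ← Polynomial.smul_eq_C_mul]⟩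

/-! ### Chebyshev polynomials of the increments -/

theorem aeval_chaos_mem_tameAlgebra (ℓ : ℝ≥0 × ℝ≥0) (p : Polynomial ℂ) :
    Polynomial.aeval (chaos [ℓ]) p ∈ tameAlgebra :=
  Algebra.adjoin_le (by simpa using chaos_mem_tameAlgebra [ℓ])
    (Polynomial.aeval_mem_adjoin_singleton ℂ (chaos [ℓ]))

/-- Up to a negligible sequence, the `r`-th Chebyshev polynomial of `chaos [ℓ]` prefixes `r` copies
of `ℓ` to a word, provided that there is nothing to annihilate at the head of that word. -/
theorem chaos_mul_aeval_scaledChebyshev_sub_mem (ℓ : ℝ≥0 × ℝ≥0) (w : List (ℝ≥0 × ℝ≥0))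
    (hw : ∀ ℓ' ∈ w.head?, overlap ℓ ℓ' = 0) (r : ℕ) :
    chaos w * Polynomial.aeval (chaos [ℓ]) (scaledChebyshev (overlap ℓ ℓ : ℂ) r) -
      chaos (List.replicate r ℓ ++ w) ∈ negligible := by
  induction r using Nat.twoStepInduction with
  | zero => simp [scaledChebyshev]
  | one =>
    cases w with
    | nil => simp [scaledChebyshev, chaos_nil]
    | cons ℓ' w =>
      have h := chaos_cons_mul_sub_mem_negligible ℓ ℓ' w
      rw [hw ℓ' (by simp)] at h
      simpa [scaledChebyshev] using h
  | more r h0 h1 =>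
    have e1 := negligible_mul h1 (chaos_mem_tameAlgebra [ℓ])
    have e2 := chaos_cons_mul_sub_mem_negligible ℓ ℓ (List.replicate r ℓ ++ w)
    have e3 := negligible.smul_mem (overlap ℓ ℓ : ℂ) h0
    have e := negligible.sub_mem (negligible.add_mem e1 e2) e3
    convert e using 1
    simp only [scaledChebyshev, map_sub, map_mul, Polynomial.aeval_X, Polynomial.aeval_C,
      ← Algebra.smul_def, List.replicate_succ, List.cons_append, mul_sub, sub_mul, smul_sub,
      mul_smul_comm, mul_assoc]
    abel

theorem aeval_scaledChebyshev_sub_mem_negligible (ℓ : ℝ≥0 × ℝ≥0) (r : ℕ) :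
    Polynomial.aeval (chaos [ℓ]) (scaledChebyshev (overlap ℓ ℓ : ℂ) r) -
      chaos (List.replicate r ℓ) ∈ negligible := by
  simpa [chaos_nil] using chaos_mul_aeval_scaledChebyshev_sub_mem ℓ [] (by simp) r

/-- The sequences that are, up to negligible ones, combinations of the `chaos w` with `w ∈ S`. -/
noncomputable def chaosSpan (S : Set (List (ℝ≥0 × ℝ≥0))) : Submodule ℂ PermSeq :=
  Submodule.span ℂ (chaos '' S) ⊔ negligible

theorem chaos_mem_chaosSpan {S : Set (List (ℝ≥0 × ℝ≥0))} {w : List (ℝ≥0 × ℝ≥0)} (hw : w ∈ S) :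
    chaos w ∈ chaosSpan S :=
  Submodule.mem_sup_left (Submodule.subset_span ⟨w, hw, rfl⟩)

theorem negligible_le_chaosSpan (S : Set (List (ℝ≥0 × ℝ≥0))) : negligible ≤ chaosSpan S :=
  le_sup_right

theorem mem_chaosSpan_of_sub_mem {S : Set (List (ℝ≥0 × ℝ≥0))} {x y : PermSeq}
    (h : x - y ∈ negligible) (hy : y ∈ chaosSpan S) : x ∈ chaosSpan S := by
  rw [← sub_add_cancel x y]
  exact Submodule.add_mem _ (negligible_le_chaosSpan S h) hy

theorem mul_mem_chaosSpan {S S' : Set (List (ℝ≥0 × ℝ≥0))} {x y : PermSeq} (hx : x ∈ chaosSpan S)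
    (hy : y ∈ tameAlgebra) (h : ∀ w ∈ S, chaos w * y ∈ chaosSpan S') : x * y ∈ chaosSpan S' := by
  have : chaosSpan S ≤ (chaosSpan S').comap (LinearMap.mulRight ℂ y) := by
    refine sup_le (Submodule.span_le.2 ?_) fun z hz => ?_
    · rintro _ ⟨w, hw, rfl⟩
      exact h w hw
    · exact negligible_le_chaosSpan _ (negligible_mul hz hy)
  exact this hx

theorem mul_chaos_singleton_mem_chaosSpan {x : PermSeq} (hx : x ∈ chaosSpan Set.univ)
    (ℓ : ℝ≥0 × ℝ≥0) : x * chaos [ℓ] ∈ chaosSpan Set.univ := by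
  refine mul_mem_chaosSpan hx (chaos_mem_tameAlgebra _) fun w _ => ?_
  cases w with
  | nil => rw [chaos_nil, one_mul]; exact chaos_mem_chaosSpan trivial
  | cons ℓ' w =>
    exact mem_chaosSpan_of_sub_mem (chaos_cons_mul_sub_mem_negligible ℓ ℓ' w)
      (Submodule.add_mem _ (chaos_mem_chaosSpan trivial)
        (Submodule.smul_mem _ _ (chaos_mem_chaosSpan trivial)))

theorem mul_centered_mem_chaosSpan {S : Set (List (ℝ≥0 × ℝ≥0))} {ℓ : ℝ≥0 × ℝ≥0}
    (hS : ∀ w ∈ S, ∀ ℓ' ∈ w.head?, overlap ℓ ℓ' = 0) {x : PermSeq} (hx : x ∈ chaosSpan S)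
    {q : Polynomial ℂ} (hq : q ∈ centeredPolynomials (overlap ℓ ℓ : ℂ)) :
    x * Polynomial.aeval (chaos [ℓ]) q ∈ chaosSpan {w | w.head? = some ℓ} := by
  refine mul_mem_chaosSpan hx (aeval_chaos_mem_tameAlgebra _ _) fun w hw => ?_
  unfold centeredPolynomials at hq
  induction hq using Submodule.span_induction with
  | mem q hq =>
    obtain ⟨r, rfl⟩ := hq
    exact mem_chaosSpan_of_sub_mem (chaos_mul_aeval_scaledChebyshev_sub_mem ℓ w (hS w hw) (r + 1))
      (chaos_mem_chaosSpan (by simp [List.replicate_succ]))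
  | zero => simp
  | add p q _ _ hp hq => rw [map_add, mul_add]; exact Submodule.add_mem _ hp hq
  | smul c q _ hq => rw [map_smul, mul_smul_comm]; exact Submodule.smul_mem _ _ hq

theorem exists_tendsto_trace_of_mem_chaosSpan {x : PermSeq} (hx : x ∈ chaosSpan Set.univ) :
    ∃ c, Filter.Tendsto (fun n => permTrace (x n)) Filter.atTop (nhds c) := by
  obtain ⟨y, hy, z, hz, rfl⟩ := Submodule.mem_sup.1 hx
  suffices h : ∃ c, Filter.Tendsto (fun n => permTrace (y n)) Filter.atTop (nhds c) by
    obtain ⟨c, hc⟩ := h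
    exact ⟨c + 0, by simpa using hc.add (tendsto_trace_of_mem_negligible hz)⟩
  clear hx hz
  induction hy using Submodule.span_induction with
  | mem y hy =>
    obtain ⟨w, -, rfl⟩ := hy
    cases w with
    | nil => exact ⟨1, by simp [chaos_nil, (groupAlgebraTrace finitePerm).map_one]⟩
    | cons ℓ w =>
      exact ⟨0, by simp only [permTrace_chaos (List.cons_ne_nil ℓ w), tendsto_const_nhds]⟩
  | zero => exact ⟨0, by simp⟩
  | add y z _ _ hy hz =>
    obtain ⟨c, hc⟩ := hy
    obtain ⟨d, hd⟩ := hz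
    exact ⟨c + d, by simpa using hc.add hd⟩
  | smul a y _ hy =>
    obtain ⟨c, hc⟩ := hy
    exact ⟨a * c, by simpa using hc.const_mul a⟩

theorem tendsto_trace_zero_of_mem_chaosSpan {S : Set (List (ℝ≥0 × ℝ≥0))} (hS : [] ∉ S)
    {x : PermSeq} (hx : x ∈ chaosSpan S) :
    Filter.Tendsto (fun n => permTrace (x n)) Filter.atTop (nhds 0) := by
  obtain ⟨y, hy, z, hz, rfl⟩ := Submodule.mem_sup.1 hx
  have h : ∀ n, permTrace (y n) = 0 := by
    intro n
    clear hx
    induction hy using Submodule.span_induction with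
    | mem y hy =>
      obtain ⟨w, hw, rfl⟩ := hy
      exact permTrace_chaos (by rintro rfl; exact hS hw) n
    | zero => simp
    | add y z _ _ hy hz => simp [hy, hz]
    | smul a y _ hy => simp [hy]
  simpa [h] using tendsto_trace_of_mem_negligible hz

/-! ### Chebyshev polynomials and the semicircle law -/

theorem integral_chebyshev_mul_semicircleWeight (r : ℕ) :
    ∫ y in (-2 : ℝ)..2, (Polynomial.Chebyshev.S ℝ r).eval y * semicircleWeight y =
      if r = 0 then 1 else 0 := by
  -- the substitution `y = 2 cos θ`
  have hsub : ∫ y in (-2 : ℝ)..2, (Polynomial.Chebyshev.S ℝ r).eval y * semicircleWeight y =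
      ∫ θ in (0 : ℝ)..Real.pi, 2 / Real.pi * (Real.sin ((r + 1) * θ) * Real.sin θ) := by
    have h := intervalIntegral.integral_comp_mul_deriv (a := Real.pi) (b := 0)
      (f := fun θ => 2 * Real.cos θ) (f' := fun θ => -(2 * Real.sin θ))
      (g := fun y => (Polynomial.Chebyshev.S ℝ r).eval y * semicircleWeight y)
      (fun θ _ => by simpa using (Real.hasDerivAt_cos θ).const_mul 2)
      (by fun_prop) (by unfold semicircleWeight; fun_prop)
    simp only [Real.cos_pi, Real.cos_zero, mul_neg, mul_one] at h
    rw [← h, intervalIntegral.integral_symm, ← intervalIntegral.integral_neg]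
    refine intervalIntegral.integral_congr fun θ hθ => ?_
    rw [Set.uIcc_of_le Real.pi_pos.le] at hθ
    have hs : 0 ≤ Real.sin θ := Real.sin_nonneg_of_mem_Icc hθ
    have hsq : Real.sqrt (4 - (2 * Real.cos θ) ^ 2) = 2 * Real.sin θ := by
      rw [show 4 - (2 * Real.cos θ) ^ 2 = (2 * Real.sin θ) ^ 2 by
        nlinarith [Real.sin_sq_add_cos_sq θ]]
      exact Real.sqrt_sq (by positivity)
    have hS := Polynomial.Chebyshev.S_two_mul_real_cos θ (r : ℤ)
    push_cast at hS
    simp only [Function.comp, semicircleWeight, hsq]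
    rw [← hS]
    field_simp
  rw [hsub, intervalIntegral.integral_const_mul]
  have hprod : ∀ θ : ℝ, Real.sin ((r + 1) * θ) * Real.sin θ =
      (Real.cos (r * θ) - Real.cos ((r + 2) * θ)) / 2 := by
    intro θ
    rw [show (r : ℝ) * θ = (r + 1) * θ - θ by ring, show ((r : ℝ) + 2) * θ = (r + 1) * θ + θ by ring,
      Real.cos_sub, Real.cos_add]
    ring
  have hcos : ∀ k : ℕ, k ≠ 0 → ∫ θ in (0 : ℝ)..Real.pi, Real.cos (k * θ) = 0 := by
    intro k hk
    have : (k : ℝ) ≠ 0 := by exact_mod_cast hk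
    rw [intervalIntegral.integral_comp_mul_left _ this, integral_cos]
    simp [Real.sin_nat_mul_pi]
  have hint : ∀ k : ℝ, IntervalIntegrable (fun θ => Real.cos (k * θ)) MeasureTheory.volume 0
      Real.pi := fun k => (by fun_prop : Continuous _).intervalIntegrable _ _
  simp only [hprod]
  rw [intervalIntegral.integral_div, intervalIntegral.integral_sub (hint _) (hint _)]
  have h2 := hcos (r + 2) (by omega)
  push_cast at h2
  rw [h2]
  split_ifs with hr
  · subst hr
    simp
  · rw [hcos r hr]
    simp

theorem integral_centered_mul_semicircleWeight (s : ℝ) {q : Polynomial ℂ}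
    (hq : q ∈ centeredPolynomials ((s : ℂ) ^ 2)) :
    ∫ y in (-2 : ℝ)..2, q.eval ((s : ℂ) * y) * (semicircleWeight y : ℂ) = 0 := by
  have hint : ∀ p : Polynomial ℂ, IntervalIntegrable
      (fun y : ℝ => p.eval ((s : ℂ) * y) * (semicircleWeight y : ℂ)) MeasureTheory.volume (-2) 2 :=
    fun p => Continuous.intervalIntegrable (by unfold semicircleWeight; fun_prop) _ _
  unfold centeredPolynomials at hq
  induction hq using Submodule.span_induction with
  | mem q hq =>
    obtain ⟨r, rfl⟩ := hq
    have h : ∀ y : ℝ, (scaledChebyshev ((s : ℂ) ^ 2) (r + 1)).eval ((s : ℂ) * y) *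
        (semicircleWeight y : ℂ) = (s : ℂ) ^ (r + 1) *
        (((Polynomial.Chebyshev.S ℝ ((r + 1 : ℕ) : ℤ)).eval y * semicircleWeight y : ℝ) : ℂ) := by
      intro y
      have := aeval_smul_scaledChebyshev (s : ℂ) (y : ℂ) (r + 1)
      rw [Polynomial.coe_aeval_eq_eval, Polynomial.coe_aeval_eq_eval, smul_eq_mul, smul_eq_mul]
        at this
      rw [this, Complex.ofReal_mul, ← mul_assoc]
      congr 2
      exact (Polynomial.Chebyshev.algebraMap_eval_S (R' := ℂ) y _).symm
    simp only [h]
    rw [intervalIntegral.integral_const_mul, intervalIntegral.integral_ofReal,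
      integral_chebyshev_mul_semicircleWeight]
    simp
  | zero => simp
  | add p q _ _ hp hq =>
    simp only [Polynomial.eval_add, add_mul]
    rw [intervalIntegral.integral_add (hint p) (hint q), hp, hq, add_zero]
  | smul c q _ hq =>
    simp only [Polynomial.eval_smul, smul_eq_mul, mul_assoc]
    rw [intervalIntegral.integral_const_mul, hq, mul_zero]

theorem integral_eval_C_add_centered (s : ℝ) (c : ℂ) {q : Polynomial ℂ}
    (hq : q ∈ centeredPolynomials ((s : ℂ) ^ 2)) :
    ∫ y in (-2 : ℝ)..2, (Polynomial.C c + q).eval ((s : ℂ) * y) * (semicircleWeight y : ℂ) = c := by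
  have h0 := integral_chebyshev_mul_semicircleWeight 0
  simp only [Nat.cast_zero, Polynomial.Chebyshev.S_zero, Polynomial.eval_one, one_mul,
    if_true] at h0
  simp only [Polynomial.eval_add, Polynomial.eval_C, add_mul]
  rw [intervalIntegral.integral_add, integral_centered_mul_semicircleWeight s hq,
    intervalIntegral.integral_const_mul, intervalIntegral.integral_ofReal, h0]
  · simp
  all_goals
    exact Continuous.intervalIntegrable (by unfold semicircleWeight; fun_prop) _ _

/-! ### The limiting noncommutative probability space -/

theorem isSelfAdjoint_chaos_singleton (ℓ : ℝ≥0 × ℝ≥0) : IsSelfAdjoint (chaos [ℓ]) := by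
  have hinv : ∀ b, (cyc [b])⁻¹ = cyc [b] := fun b =>
    Subtype.ext (by rw [Subgroup.coe_inv, coe_cyc_singleton, Equiv.swap_inv])
  funext n
  change star (chaos [ℓ] n) = chaos [ℓ] n
  rw [chaos, rawSum_singleton, star_smul, star_sum]
  simp [groupAlgebra_star_single, hinv]

/-- The algebra of sequences generated by the normalized sums of transpositions `(0 a)`. -/
noncomputable def brownianAlgebra : StarSubalgebra ℂ PermSeq :=
  StarAlgebra.adjoin ℂ (Set.range fun ℓ => chaos [ℓ])

theorem brownianAlgebra_toSubalgebra :
    brownianAlgebra.toSubalgebra = Algebra.adjoin ℂ (Set.range fun ℓ => chaos [ℓ]) := by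
  rw [brownianAlgebra, StarAlgebra.adjoin_toSubalgebra]
  congr 1
  refine Set.union_eq_left.2 fun x hx => ?_
  obtain ⟨ℓ, hℓ⟩ := hx
  exact ⟨ℓ, by rw [← star_star x, ← hℓ]; exact (isSelfAdjoint_chaos_singleton ℓ).symm⟩

theorem mem_chaosSpan_of_mem_brownianAlgebra {x : PermSeq} (hx : x ∈ brownianAlgebra) :
    x ∈ chaosSpan Set.univ := by
  have hx' : x ∈ Algebra.adjoin ℂ (Set.range fun ℓ => chaos [ℓ]) := by
    rwa [← brownianAlgebra_toSubalgebra]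
  suffices h : ∀ y ∈ chaosSpan Set.univ, y * x ∈ chaosSpan Set.univ by
    simpa [chaos_nil] using h _ (chaos_mem_chaosSpan (w := []) trivial)
  clear hx
  induction hx' using Algebra.adjoin_induction with
  | mem x hx =>
    obtain ⟨ℓ, rfl⟩ := hx
    exact fun y hy => mul_chaos_singleton_mem_chaosSpan hy ℓ
  | algebraMap c =>
    intro y hy
    rw [← Algebra.commutes, ← Algebra.smul_def]
    exact Submodule.smul_mem _ _ hy
  | add x z _ _ hx hz => intro y hy; rw [mul_add]; exact Submodule.add_mem _ (hx y hy) (hz y hy)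
  | mul x z _ _ hx hz => intro y hy; rw [← mul_assoc]; exact hz _ (hx y hy)

theorem mem_tameAlgebra_of_mem_brownianAlgebra {x : PermSeq} (hx : x ∈ brownianAlgebra) :
    x ∈ tameAlgebra := by
  have hx' : x ∈ Algebra.adjoin ℂ (Set.range fun ℓ => chaos [ℓ]) := by
    rwa [← brownianAlgebra_toSubalgebra]
  refine Algebra.adjoin_le ?_ hx'
  rintro _ ⟨ℓ, rfl⟩
  exact chaos_mem_tameAlgebra _

theorem tendsto_trace_limUnder (x : brownianAlgebra) :
    Filter.Tendsto (fun n => permTrace (x.1 n)) Filter.atTop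
      (nhds (Filter.limUnder Filter.atTop fun n => permTrace (x.1 n))) :=
  tendsto_nhds_limUnder
    (exists_tendsto_trace_of_mem_chaosSpan (mem_chaosSpan_of_mem_brownianAlgebra x.2))

/-- The limit of the traces, as a state on the algebra of sequences. -/
noncomputable def limitState : NCState brownianAlgebra where
  toLinearMap :=
    { toFun := fun x => Filter.limUnder Filter.atTop fun n => permTrace (x.1 n)
      map_add' := fun x y => tendsto_nhds_unique (tendsto_trace_limUnder (x + y)) (by
        simpa using (tendsto_trace_limUnder x).add (tendsto_trace_limUnder y))
      map_smul' := fun c x => tendsto_nhds_unique (tendsto_trace_limUnder (c • x)) (by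
        simpa using (tendsto_trace_limUnder x).const_mul c) }
  map_one := tendsto_nhds_unique (tendsto_trace_limUnder 1) (by
    simp [(groupAlgebraTrace finitePerm).map_one])
  map_star x := tendsto_nhds_unique (tendsto_trace_limUnder (star x)) (by
    refine ((tendsto_trace_limUnder x).star).congr fun n => ?_
    exact ((groupAlgebraTrace finitePerm).map_star _).symm)
  map_mul_star_nonneg x := ge_of_tendsto' (tendsto_trace_limUnder (x * star x)) fun n =>
    (groupAlgebraTrace finitePerm).map_mul_star_nonneg (x.1 n)

theorem tendsto_limitState (x : brownianAlgebra) :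
    Filter.Tendsto (fun n => permTrace (x.1 n)) Filter.atTop
      (nhds (limitState.toLinearMap x)) :=
  tendsto_trace_limUnder x

theorem limitState_eq_zero {S : Set (List (ℝ≥0 × ℝ≥0))} (hS : [] ∉ S) {x : brownianAlgebra}
    (hx : x.1 ∈ chaosSpan S) : limitState.toLinearMap x = 0 :=
  tendsto_nhds_unique (tendsto_limitState x) (tendsto_trace_zero_of_mem_chaosSpan hS hx)

/-- The normalized sum of the transpositions `(0 a)`, `a ∈ (n s, n t]`, for `ℓ = (s, t)`. -/
noncomputable def increment (ℓ : ℝ≥0 × ℝ≥0) : brownianAlgebra :=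
  ⟨chaos [ℓ], StarAlgebra.subset_adjoin _ _ ⟨ℓ, rfl⟩⟩

theorem isSelfAdjoint_increment (ℓ : ℝ≥0 × ℝ≥0) : IsSelfAdjoint (increment ℓ) :=
  Subtype.ext (isSelfAdjoint_chaos_singleton ℓ)

theorem coe_aeval_increment (ℓ : ℝ≥0 × ℝ≥0) (p : Polynomial ℂ) :
    ((Polynomial.aeval (increment ℓ) p : brownianAlgebra) : PermSeq) =
      Polynomial.aeval (chaos [ℓ]) p :=
  (Polynomial.aeval_algHom_apply brownianAlgebra.subtype.toAlgHom (increment ℓ) p).symm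

theorem limitState_aeval_centered (ℓ : ℝ≥0 × ℝ≥0) {q : Polynomial ℂ}
    (hq : q ∈ centeredPolynomials (overlap ℓ ℓ : ℂ)) :
    limitState.toLinearMap (Polynomial.aeval (increment ℓ) q) = 0 := by
  refine limitState_eq_zero (S := {w | w.head? = some ℓ}) (by simp) ?_
  rw [coe_aeval_increment]
  simpa [chaos_nil] using mul_centered_mem_chaosSpan (S := {[]}) (ℓ := ℓ) (by simp)
    (chaos_mem_chaosSpan (w := []) rfl) hq

theorem limitState_aeval_C_add_centered (ℓ : ℝ≥0 × ℝ≥0) (c : ℂ) {q : Polynomial ℂ}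
    (hq : q ∈ centeredPolynomials (overlap ℓ ℓ : ℂ)) :
    limitState.toLinearMap (Polynomial.aeval (increment ℓ) (Polynomial.C c + q)) = c := by
  rw [map_add, map_add, limitState_aeval_centered ℓ hq, Polynomial.aeval_C,
    Algebra.algebraMap_eq_smul_one, map_smul, limitState.map_one]
  simp

theorem exists_centered_of_mem_adjoin {ℓ : ℝ≥0 × ℝ≥0} {a : brownianAlgebra}
    (ha : a ∈ StarAlgebra.adjoin ℂ {increment ℓ}) (h0 : limitState.toLinearMap a = 0) :
    ∃ q ∈ centeredPolynomials (overlap ℓ ℓ : ℂ), Polynomial.aeval (increment ℓ) q = a := by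
  have ha' : a ∈ Algebra.adjoin ℂ {increment ℓ} := by
    have : a ∈ (StarAlgebra.adjoin ℂ {increment ℓ}).toSubalgebra := ha
    rwa [StarAlgebra.adjoin_toSubalgebra, Set.star_singleton, isSelfAdjoint_increment,
      Set.union_self] at this
  rw [Algebra.adjoin_singleton_eq_range_aeval] at ha'
  obtain ⟨p, rfl⟩ := ha'
  obtain ⟨c, q, hq, rfl⟩ := exists_eq_C_add_centered (overlap ℓ ℓ : ℂ) p
  have hc : c = 0 := (limitState_aeval_C_add_centered ℓ c hq).symm.trans h0
  exact ⟨q, hq, by simp [hc]⟩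

/-- Increments over intervals with null intersections are free: an alternating product of
centered polynomials in them only involves nonempty words, since no annihilation takes place. -/
theorem isFreeFamily_increment {I : Type*} (ℓ : I → ℝ≥0 × ℝ≥0)
    (hℓ : ∀ i j, i ≠ j → overlap (ℓ i) (ℓ j) = 0) :
    IsFreeFamily limitState fun i => increment (ℓ i) := by
  intro k i a hi ha h0
  refine limitState_eq_zero (S := {w | w.head? = some (ℓ (i (Fin.last k)))}) (by simp) ?_
  induction k with
  | zero =>
    obtain ⟨q, hq, hqa⟩ := exists_centered_of_mem_adjoin (ha 0) (h0 0)
    have h := mul_centered_mem_chaosSpan (S := {[]}) (ℓ := ℓ (i 0)) (by simp)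
      (chaos_mem_chaosSpan (w := []) rfl) hq
    rw [chaos_nil, one_mul, ← coe_aeval_increment, hqa] at h
    simpa using h
  | succ k ih =>
    have h := ih (fun j => i j.castSucc) (fun j => a j.castSucc) (fun j => hi j.castSucc)
      (fun j => ha _) (fun j => h0 _)
    obtain ⟨q, hq, hqa⟩ := exists_centered_of_mem_adjoin (ha (Fin.last _)) (h0 (Fin.last _))
    have h' := mul_centered_mem_chaosSpan (ℓ := ℓ (i (Fin.last (k + 1)))) (by
      intro w hw ℓ' hℓ'
      rw [Set.mem_ofPred_eq] at hw
      rw [hw, Option.mem_some_iff] at hℓ'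
      subst hℓ'
      exact hℓ _ _ (hi (Fin.last k)).symm) h hq
    rw [← coe_aeval_increment, hqa] at h'
    rw [List.ofFn_succ', List.prod_concat]
    exact h'

theorem overlap_eq_zero_of_le {ℓ ℓ' : ℝ≥0 × ℝ≥0} (h : ℓ.2 ≤ ℓ'.1) : overlap ℓ ℓ' = 0 := by
  refine max_eq_left (sub_nonpos.2 ((min_le_left _ _).trans (le_trans ?_ (le_max_right _ _))))
  exact_mod_cast h

theorem overlap_comm (ℓ ℓ' : ℝ≥0 × ℝ≥0) : overlap ℓ ℓ' = overlap ℓ' ℓ := by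
  rw [overlap, overlap, min_comm, max_comm (ℓ.1 : ℝ)]

theorem overlap_zero_self (t : ℝ≥0) : overlap (0, t) (0, t) = t := by
  simp [overlap]

theorem increment_sub_increment {s t : ℝ≥0} (h : s ≤ t) :
    increment (0, t) - increment (0, s) = increment (s, t) := by
  apply Subtype.ext
  change chaos [(0, t)] - chaos [(0, s)] = chaos [(s, t)]
  funext n
  have hfl : ⌊(n : ℝ) * s⌋₊ ≤ ⌊(n : ℝ) * t⌋₊ := Nat.floor_le_floor (by gcongr)
  simp only [Pi.sub_apply, chaos, rawSum_singleton, List.length_singleton, scaledInterval]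
  rw [← smul_sub, ← Finset.sum_Ioc_consecutive _ (by simp) hfl]
  simp

theorem isSemicircular_increment (t : ℝ≥0) : IsSemicircular limitState (increment (0, t)) t := by
  refine ⟨isSelfAdjoint_increment _, fun k => ?_⟩
  obtain ⟨c, q, hq, hp⟩ := exists_eq_C_add_centered (t : ℂ) (Polynomial.X ^ k)
  have h1 := limitState_aeval_C_add_centered (0, t) c (q := q) (by
    rw [overlap_zero_self]; exact hq)
  have hs : ((Real.sqrt t : ℝ) : ℂ) ^ 2 = (t : ℂ) := by
    rw [← Complex.ofReal_pow, Real.sq_sqrt (NNReal.coe_nonneg t)]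
  have h2 := integral_eval_C_add_centered (Real.sqrt t) c (q := q) (by rw [hs]; exact hq)
  rw [← hp] at h1 h2
  rw [map_pow, Polynomial.aeval_X] at h1
  rw [h1, ← h2, ← intervalIntegral.integral_ofReal]
  simp

theorem isFreeBrownianMotion_increment :
    IsFreeBrownianMotion limitState fun t => increment (0, t) where
  semicircular := isSemicircular_increment
  free_increments p t ht := by
    have : (fun j : Fin p => increment (0, t j.succ) - increment (0, t j.castSucc)) =
        fun j : Fin p => increment (t j.castSucc, t j.succ) :=
      funext fun j => increment_sub_increment (ht.monotone (Fin.castSucc_lt_succ).le)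
    rw [this]
    refine isFreeFamily_increment _ fun i j hij => ?_
    have key : ∀ i j : Fin p, i < j →
        overlap (t i.castSucc, t i.succ) (t j.castSucc, t j.succ) = 0 := fun i j h =>
      overlap_eq_zero_of_le (ht.monotone (by rw [Fin.le_iff_val_le_val]; simpa using h))
    rcases lt_or_gt_of_ne hij with h | h
    · exact key i j h
    · rw [overlap_comm]; exact key j i h

/-! ### The limit of the cycle sums -/

theorem cycleSum_eq_chaos (r n : ℕ) (t : ℝ≥0) :
    cycleSum r n t = chaos (List.replicate r (0, t)) n := by
  have hcoef : 1 / (n : ℝ) ^ ((r : ℝ) / 2) = (√(n : ℝ))⁻¹ ^ r := by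
    rw [one_div, inv_pow, Real.sqrt_eq_rpow, ← Real.rpow_natCast, ← Real.rpow_mul
      (Nat.cast_nonneg n)]
    ring_nf
  rw [cycleSum, chaos, hcoef, List.length_replicate]
  congr 1
  have hI : scaledInterval n (0, t) = Finset.Icc 1 ⌊(n : ℝ) * t⌋₊ := by
    ext x; simp [scaledInterval, Nat.succ_le_iff, Nat.pos_iff_ne_zero]
  refine Finset.sum_bij (fun a _ => List.ofFn a) ?_ ?_ ?_ ?_
  · intro a ha
    simp only [distinctTuples, Finset.mem_filter, Fintype.mem_piFinset] at ha
    refine mem_wordSet_iff.2 ⟨?_, List.nodup_ofFn.2 ha.2⟩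
    rw [List.forall₂_iff_get]
    simp only [List.length_ofFn, List.length_replicate, true_and, List.get_ofFn]
    intro j h1 h2
    simpa [hI] using ha.1 ⟨j, h1⟩
  · exact fun a _ b _ h => List.ofFn_injective h
  · intro l hl
    obtain ⟨h1, h2⟩ := mem_wordSet_iff.1 hl
    have hlen : l.length = r := by simpa using h1.length_eq
    subst hlen
    refine ⟨l.get, ?_, List.ofFn_get l⟩
    simp only [distinctTuples, Finset.mem_filter, Fintype.mem_piFinset]
    refine ⟨fun j => ?_, List.nodup_iff_injective_get.1 h2⟩
    rw [List.forall₂_iff_get] at h1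
    simpa [hI] using h1.2 j.1 j.2 (by simp)
  · intro a _
    rfl

/-- The limit of the `r`-th cycle sum at time `t`, as a polynomial in the Brownian motion. -/
noncomputable def limitCycleSum (r : ℕ+) (t : ℝ≥0) : brownianAlgebra :=
  Polynomial.aeval (increment (0, t)) (scaledChebyshev (t : ℂ) r)

theorem isSelfAdjoint_aeval_scaledChebyshev {A : Type*} [Ring A] [StarRing A] [Algebra ℂ A]
    [StarModule ℂ A] {x : A} (hx : IsSelfAdjoint x) (t : ℝ) (r : ℕ) :
    IsSelfAdjoint (Polynomial.aeval x (scaledChebyshev (t : ℂ) r)) := by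
  induction r using Nat.twoStepInduction with
  | zero => simp [scaledChebyshev]
  | one => simpa [scaledChebyshev] using hx
  | more r h0 h1 =>
    simp only [scaledChebyshev, map_sub, map_mul, Polynomial.aeval_X, Polynomial.aeval_C,
      ← Algebra.smul_def]
    refine IsSelfAdjoint.sub ?_ (IsSelfAdjoint.smul (Complex.conj_ofReal t) h0)
    have hcomm : Commute (Polynomial.aeval x (scaledChebyshev (t : ℂ) (r + 1))) x := by
      have := (Polynomial.commute_X (scaledChebyshev (t : ℂ) (r + 1))).symm.map
        (Polynomial.aeval (R := ℂ) x)
      simpa using this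
    exact (h1.commute_iff hx).1 hcomm

theorem limitCycleSum_one : limitCycleSum 1 = fun t => increment (0, t) := by
  funext t
  simp [limitCycleSum, scaledChebyshev]

theorem increment_self (t : ℝ≥0) : increment (t, t) = 0 := by
  rw [← increment_sub_increment le_rfl, sub_self]

theorem limitCycleSum_zero (r : ℕ+) : limitCycleSum r 0 = 0 := by
  have h := aeval_smul_scaledChebyshev (0 : ℂ) (0 : brownianAlgebra) r
  rw [zero_pow (by norm_num), zero_pow r.ne_zero, zero_smul, zero_smul] at h
  rw [limitCycleSum, increment_self]
  simpa using h

theorem limitCycleSum_eq (r : ℕ+) {t : ℝ≥0} (ht : 0 < t) :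
    limitCycleSum r t = (((t : ℝ) ^ (((r : ℕ) : ℝ) / 2) : ℝ) : ℂ) •
      Polynomial.aeval ((((t : ℝ) ^ (-1 / 2 : ℝ) : ℝ) : ℂ) • increment (0, t))
        (Polynomial.Chebyshev.S ℂ (r : ℕ)) := by
  have ht' : (0 : ℝ) < t := ht
  have h := aeval_smul_scaledChebyshev (((t : ℝ) ^ (1 / 2 : ℝ) : ℝ) : ℂ)
    ((((t : ℝ) ^ (-1 / 2 : ℝ) : ℝ) : ℂ) • increment (0, t)) r
  rw [smul_smul, ← Complex.ofReal_mul, ← Real.rpow_add ht', ← Complex.ofReal_pow,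
    ← Complex.ofReal_pow, ← Real.rpow_natCast, ← Real.rpow_natCast, ← Real.rpow_mul ht'.le,
    ← Real.rpow_mul ht'.le, show (1 / 2 : ℝ) + -1 / 2 = 0 by norm_num,
    show (1 / 2 : ℝ) * (2 : ℕ) = 1 by norm_num, Real.rpow_zero, Real.rpow_one,
    Complex.ofReal_one, one_smul, one_div_mul_eq_div] at h
  exact h

/-- Two families of tame sequences that agree up to negligible ones have the same asymptotic
distribution. -/
theorem lift_sub_lift_mem_negligible {I : Type*} {x y : I → PermSeq}
    (hx : ∀ i, x i ∈ tameAlgebra) (hy : ∀ i, y i ∈ tameAlgebra)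
    (hxy : ∀ i, x i - y i ∈ negligible) (P : FreeAlgebra ℂ I) :
    FreeAlgebra.lift ℂ x P - FreeAlgebra.lift ℂ y P ∈ negligible := by
  suffices h : FreeAlgebra.lift ℂ x P ∈ tameAlgebra ∧ FreeAlgebra.lift ℂ y P ∈ tameAlgebra ∧
      FreeAlgebra.lift ℂ x P - FreeAlgebra.lift ℂ y P ∈ negligible from h.2.2
  induction P using FreeAlgebra.induction with
  | grade0 c =>
    simp only [AlgHom.commutes, sub_self]
    exact ⟨tameAlgebra.algebraMap_mem c, tameAlgebra.algebraMap_mem c, negligible.zero_mem⟩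
  | grade1 i => simpa using ⟨hx i, hy i, hxy i⟩
  | mul P Q hP hQ =>
    simp only [map_mul]
    refine ⟨tameAlgebra.mul_mem hP.1 hQ.1, tameAlgebra.mul_mem hP.2.1 hQ.2.1, ?_⟩
    have := negligible.add_mem (negligible_mul hP.2.2 hQ.1) (mul_negligible hQ.2.2 hP.2.1)
    convert this using 1
    rw [sub_mul, mul_sub]
    abel
  | add P Q hP hQ =>
    simp only [map_add]
    refine ⟨tameAlgebra.add_mem hP.1 hQ.1, tameAlgebra.add_mem hP.2.1 hQ.2.1, ?_⟩
    rw [add_sub_add_comm]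
    exact negligible.add_mem hP.2.2 hQ.2.2

theorem tendsto_ncDistribution_cycleSum (P : FreeAlgebra ℂ (ℕ+ × ℝ≥0)) :
    Filter.Tendsto
      (fun n : ℕ => ncDistribution (groupAlgebraTrace finitePerm)
        (fun q : ℕ+ × ℝ≥0 => cycleSum q.1 n q.2) P)
      Filter.atTop
      (nhds (ncDistribution limitState (fun q : ℕ+ × ℝ≥0 => limitCycleSum q.1 q.2) P)) := by
  let x : ℕ+ × ℝ≥0 → PermSeq := fun q => chaos (List.replicate q.1 (0, q.2))
  let y : ℕ+ × ℝ≥0 → brownianAlgebra := fun q => limitCycleSum q.1 q.2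
  have hy : ∀ q, (y q : PermSeq) =
      Polynomial.aeval (chaos [(0, q.2)]) (scaledChebyshev (q.2 : ℂ) q.1) :=
    fun q => coe_aeval_increment _ _
  have hneg := lift_sub_lift_mem_negligible (x := x) (y := fun q => (y q : PermSeq))
    (fun q => chaos_mem_tameAlgebra _)
    (fun q => mem_tameAlgebra_of_mem_brownianAlgebra (y q).2)
    (fun q => by
      have h := aeval_scaledChebyshev_sub_mem_negligible (0, q.2) q.1
      rw [overlap_zero_self] at h
      rw [← neg_sub, hy]
      exact negligible.neg_mem h) P
  have hxn : ∀ n : ℕ, FreeAlgebra.lift ℂ x P n =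
      FreeAlgebra.lift ℂ (fun q : ℕ+ × ℝ≥0 => cycleSum q.1 n q.2) P := by
    intro n
    have : (Pi.evalAlgHom ℂ (fun _ : ℕ => MonoidAlgebra ℂ finitePerm) n).comp
        (FreeAlgebra.lift ℂ x) =
        FreeAlgebra.lift ℂ (fun q : ℕ+ × ℝ≥0 => cycleSum q.1 n q.2) := by
      ext q : 2
      simp [x, cycleSum_eq_chaos]
    exact DFunLike.congr_fun this P
  have hyn : ((FreeAlgebra.lift ℂ y P : brownianAlgebra) : PermSeq) =
      FreeAlgebra.lift ℂ (fun q => (y q : PermSeq)) P := by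
    have : brownianAlgebra.subtype.toAlgHom.comp (FreeAlgebra.lift ℂ y) =
        FreeAlgebra.lift ℂ (fun q => (y q : PermSeq)) := by
      ext q : 2
      simp
    exact DFunLike.congr_fun this P
  have h := (tendsto_trace_of_mem_negligible hneg).add (tendsto_limitState (FreeAlgebra.lift ℂ y P))
  rw [zero_add] at h
  refine h.congr fun n => ?_
  rw [hyn, Pi.sub_apply, map_sub, sub_add_cancel, hxn]
  rfl

theorem theorem1 :
    ∃ (A : Type) (_ : Ring A) (_ : StarRing A) (_ : Algebra ℂ A) (_ : StarModule ℂ A)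
      (φ : NCState A) (M : ℕ+ → ℝ≥0 → A),
      (∀ r t, IsSelfAdjoint (M r t)) ∧
      IsFreeBrownianMotion φ (M 1) ∧
      (∀ (r : ℕ+) (t : ℝ≥0), 0 < t →
        M r t = (((t : ℝ) ^ (((r : ℕ) : ℝ) / 2) : ℝ) : ℂ) •
          Polynomial.aeval ((((t : ℝ) ^ (-1 / 2 : ℝ) : ℝ) : ℂ) • M 1 t)
            (Polynomial.Chebyshev.S ℂ (r : ℕ))) ∧
      (∀ r : ℕ+, M r 0 = 0) ∧
      ∀ P : FreeAlgebra ℂ (ℕ+ × ℝ≥0),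
        Filter.Tendsto
          (fun n : ℕ => ncDistribution (groupAlgebraTrace finitePerm)
            (fun q : ℕ+ × ℝ≥0 => cycleSum q.1 n q.2) P)
          Filter.atTop (nhds (ncDistribution φ (fun q : ℕ+ × ℝ≥0 => M q.1 q.2) P)) := by
  refine ⟨brownianAlgebra, inferInstance, inferInstance, inferInstance, inferInstance, limitState,
    limitCycleSum, fun r t => ?_, ?_, fun r t ht => ?_, limitCycleSum_zero,
    tendsto_ncDistribution_cycleSum⟩
  · exact isSelfAdjoint_aeval_scaledChebyshev (isSelfAdjoint_increment _) t r
  · rw [limitCycleSum_one]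
    exact isFreeBrownianMotion_increment
  · rw [limitCycleSum_one]
    exact limitCycleSum_eq r ht
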